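/- Work with the real spherical harmonics and the identification $a_{-1}=a_x,\ a_0=a_z,\ a_1=a_y$ of a vector $\boldsymbol a\in\mathbb R^3$ with its components of degree $1$ (so, for $k>0$, index $-k$ denotes the cosine-type harmonic $(Y_l^{-k}+(-1)^kY_l^{k})/\sqrt2$ and index $k$ the sine-type harmonic $\mathrm i(Y_l^{-k}-(-1)^kY_l^{k})/\sqrt2$, with $Y_l^m$ the complex spherical harmonics with Condon–Shortley phases). For harmonic components $\boldsymbol A$, $\boldsymbol B$ of degrees $l_1,l_2$ put $$(\boldsymbol A\,\widetilde\otimes\,\boldsymbol B)_{L\mu}=\sum_{|\mu_1|\le l_1,\,|\mu_2|\le l_2}C^{L\mu}_{l_1\mu_1l_2\mu_2}A_{\mu_1}B_{\mu_2},$$ where the $C$ are the Clebsch–Gordan coefficients in the basis of real spherical harmonics. The maximal coupling of $\lambda$ vectors is $$(\boldsymbol a_1\,\widetilde\otimes\cdots\widetilde\otimes\,\boldsymbol a_\lambda)_\lambda=\big((\cdots(\boldsymbol a_1\,\widetilde\otimes\,\boldsymbol a_2)_2\,\widetilde\otimes\cdots)_{\lambda-1}\,\widetilde\otimes\,\boldsymbol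 a_\lambda\big)_\lambda,$$ which is the scalar $1$ for $\lambda=0$ and $\boldsymbol a_1$ for $\lambda=1$; write $\boldsymbol a^{\widetilde\otimes l}$ for the maximal coupling of $l$ copies of $\boldsymbol a$. For $l_1+\dots+l_n=\lambda$, let $(\boldsymbol r_1^{\widetilde\otimes l_1}\,\widetilde\otimes\cdots\widetilde\otimes\,\boldsymbol r_n^{\widetilde\otimes l_n})_\lambda$ be the successive contraction of $\boldsymbol r_1^{\widetilde\otimes l_1},\dots,\boldsymbol r_n^{\widetilde\otimes l_n}$ from the left, each time to the highest degree (the sum of the two degrees). Let $n,\lambda\ge 0$ be integers. A proper harmonic tensor of angular momentum $\lambda$ of $n$ vector inputs is a function $\boldsymbol T_\lambda:(\mathbb R^3)^n\to\mathbb R^{2\lambda+1}$, with components $T_{\lambda\mu}$, $-\lambda\le\mu\le\lambda$, such that for every rotation $R$, all inputs and all $\mu$ $$T_{\lambda\mu}(R\boldsymbol r_1,\dots,R\boldsymbol r_n)=\sum_{\mu'=-\lambda}^{\lambda}D^\lambda_{\mu\mu'}(R)\,T_{\lambda\mu'}(\boldsymbol r_1,\dots,\boldsymbol r_n),\qquad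 T_{\lambda\mu}(-\boldsymbol r_1,\dots,-\boldsymbol r_n)=(-1)^\lambda\, T_{\lambda\mu}(\boldsymbol r_1,\dots,\boldsymbol r_n),$$ where $D^\lambda(R)$ is the real Wigner $D$-matrix of $R$. A scalar function is a function $f:(\mathbb R^3)^n\to\mathbb R$ with $f(Q\boldsymbol r_1,\dots,Q\boldsymbol r_n)=f(\boldsymbol r_1,\dots,\boldsymbol r_n)$ for all $Q\in O(3)$. **Corollary 2.** If $\boldsymbol T_\lambda$ is a proper harmonic tensor of the vector inputs $\boldsymbol r_1,\dots,\boldsymbol r_n$, then there are scalar functions $f_{i_1\ldots i_\lambda}$ such that for all inputs $$\boldsymbol T_\lambda(\boldsymbol r_1,\dots,\boldsymbol r_n)=\sum_{1\le i_1\le\dots\le i_\lambda\le n}f_{i_1\ldots i_\lambda}(\boldsymbol r_1,\dots,\boldsymbol r_n)\,(\boldsymbol r_{i_1}\,\widetilde\otimes\cdots\widetilde\otimes\,\boldsymbol r_{i_\lambda})_\lambda,$$ and, equivalently, there are scalar functions $\phi_{l_1\ldots l_n}$ such that for all inputs $$\boldsymbol T_\lambda(\boldsymbol r_1,\dots,\boldsymbol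 r_n)=\sum_{\substack{l_1,\dots,l_n\ge0\\ l_1+\dots+l_n=\lambda}}\phi_{l_1\ldots l_n}(\boldsymbol r_1,\dots,\boldsymbol r_n)\,(\boldsymbol r_1^{\widetilde\otimes l_1}\,\widetilde\otimes\cdots\widetilde\otimes\,\boldsymbol r_n^{\widetilde\otimes l_n})_\lambda.$$ -/

import Mathlib

open scoped Nat

noncomputable section

/-! Clebsch-Gordan coefficients, Wigner matrices and maximal couplings for integer angular
momenta, in the basis of real spherical harmonics. -/

/-- The magnetic indices `-l, ..., l` of angular momentum `l`. -/
abbrev MIdx (l : ℕ) : Type := {m : ℤ // m ∈ Finset.Icc (-(l : ℤ)) (l : ℤ)}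

/-- The factorial of a (nonnegative) integer. -/
def zfact (z : ℤ) : ℝ := ((z.toNat)! : ℝ)

/-- The reciprocal `1 / z!` of the factorial of an integer, which is zero for negative `z`. -/
def invFact (z : ℤ) : ℝ := if 0 ≤ z then 1 / zfact z else 0

/-- The Clebsch-Gordan coefficient `⟨l₁ m₁ l₂ m₂ | L M⟩` in the basis of the standard complex
spherical harmonics (Condon-Shortley phases), by Racah's closed formula. Terms that contain the
factorial of a negative integer in a denominator vanish; in particular the coefficient is zero
unless `|l₁ - l₂| ≤ L ≤ l₁ + l₂`. -/
def clebschGordan (l₁ l₂ L : ℕ) (m₁ m₂ M : ℤ) : ℝ :=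
  if m₁ + m₂ = M then
    Real.sqrt ((2 * L + 1) * zfact (L + l₁ - l₂) * zfact (L - l₁ + l₂) * zfact (l₁ + l₂ - L)
        / zfact (l₁ + l₂ + L + 1))
      * Real.sqrt (zfact (L + M) * zfact (L - M) * zfact (l₁ - m₁) * zfact (l₁ + m₁)
        * zfact (l₂ - m₂) * zfact (l₂ + m₂))
      * ∑ k ∈ Finset.range (l₁ + l₂ + 1), (-1 : ℝ) ^ k * invFact k * invFact (l₁ + l₂ - L - k)
          * invFact (l₁ - m₁ - k) * invFact (l₂ + m₂ - k)
          * invFact (L - l₂ + m₁ + k) * invFact (L - l₁ - m₂ + k)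
  else 0

/-- The entry `d^l_{m m'}(β)` of Wigner's small matrix, by Wigner's closed formula. -/
def wignerSmallD (l : ℕ) (β : ℝ) (m m' : ℤ) : ℝ :=
  Real.sqrt (zfact (l + m) * zfact (l - m) * zfact (l + m') * zfact (l - m'))
    * ∑ s ∈ Finset.range (2 * l + 1), (-1 : ℝ) ^ (m - m' + s).toNat
        * invFact (l + m' - s) * invFact s * invFact (m - m' + s) * invFact (l - m - s)
        * Real.cos (β / 2) ^ (2 * l + m' - m - 2 * s).toNat
        * Real.sin (β / 2) ^ (m - m' + 2 * s).toNat

/-- The entry `D^l_{m m'}(α, β, γ) = e^{-i m α} d^l_{m m'}(β) e^{-i m' γ}` of Wigner's matrix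
in the basis of the standard complex spherical harmonics. -/
def wignerD (l : ℕ) (α β γ : ℝ) (m m' : ℤ) : ℂ :=
  Complex.exp (-(Complex.I * m * α)) * (wignerSmallD l β m m' : ℂ)
    * Complex.exp (-(Complex.I * m' * γ))

/-- The coefficient of the complex spherical harmonic `Y_l^m` in the real spherical harmonic with
index `μ` (the same for every degree `l`). For `k > 0` the real harmonic of index `-k` is the cosine
one, `(Y_l^{-k} + (-1)^k Y_l^k) / √2`, and that of index `k` is the sine one,
`i (Y_l^{-k} - (-1)^k Y_l^k) / √2`. For `l = 1` the real harmonics of indices `-1, 0, 1` are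
proportional to `x, z, y`. -/
def realHarmonicCoeff (μ m : ℤ) : ℂ :=
  if μ = 0 then (if m = 0 then 1 else 0)
  else if μ < 0 then
    (if m = μ then 1 / (Real.sqrt 2 : ℂ)
      else if m = -μ then (-1) ^ μ.natAbs / (Real.sqrt 2 : ℂ) else 0)
  else
    (if m = -μ then Complex.I / (Real.sqrt 2 : ℂ)
      else if m = μ then -(Complex.I * (-1) ^ μ.natAbs / (Real.sqrt 2 : ℂ)) else 0)

/-- The Clebsch-Gordan coefficient `C^{L μ}_{l₁ μ₁ l₂ μ₂}` in the basis of the real spherical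
harmonics (a complex number in general). -/
def realClebschGordan (l₁ l₂ L : ℕ) (μ₁ μ₂ μ : ℤ) : ℂ :=
  ∑ m ∈ Finset.Icc (-(L : ℤ)) L, ∑ m₁ ∈ Finset.Icc (-(l₁ : ℤ)) l₁,
    ∑ m₂ ∈ Finset.Icc (-(l₂ : ℤ)) l₂,
      (starRingEnd ℂ) (realHarmonicCoeff μ m) * (clebschGordan l₁ l₂ L m₁ m₂ m : ℂ)
        * realHarmonicCoeff μ₁ m₁ * realHarmonicCoeff μ₂ m₂

/-- The entry of Wigner's matrix in the basis of the real spherical harmonics. -/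
def realWignerD (l : ℕ) (α β γ : ℝ) (μ μ' : ℤ) : ℂ :=
  ∑ m ∈ Finset.Icc (-(l : ℤ)) l, ∑ m' ∈ Finset.Icc (-(l : ℤ)) l,
    (starRingEnd ℂ) (realHarmonicCoeff μ m) * wignerD l α β γ m m' * realHarmonicCoeff μ' m'

/-- The contraction `(A ⊗̃ B)_L` of harmonic components of degrees `l₁` and `l₂`. Only the values of
a family of components of degree `l` at the indices `-l, ..., l` are meaningful. -/
def cgContract (l₁ l₂ L : ℕ) (A B : ℤ → ℂ) : ℤ → ℂ := fun μ =>
  ∑ μ₁ ∈ Finset.Icc (-(l₁ : ℤ)) l₁, ∑ μ₂ ∈ Finset.Icc (-(l₂ : ℤ)) l₂,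
    realClebschGordan l₁ l₂ L μ₁ μ₂ μ * A μ₁ * B μ₂

/-- The harmonic components (of degree `1`) of a vector `a = (a_x, a_y, a_z)`:
`a_{-1} = a_x`, `a_0 = a_z`, `a_1 = a_y`. -/
def vecComp (a : Fin 3 → ℝ) : ℤ → ℂ := fun μ =>
  if μ = -1 then (a 0 : ℂ) else if μ = 0 then (a 2 : ℂ) else if μ = 1 then (a 1 : ℂ) else 0

/-- The components of the scalar `1` (degree `0`). -/
def unitComp : ℤ → ℂ := fun μ => if μ = 0 then 1 else 0

/-- The maximal coupling `((⋯(a₁ ⊗̃ a₂)_2 ⊗̃ ⋯)_{k-1} ⊗̃ a_k)_k` of `k` vectors; the coupling of no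
vectors is the scalar `1`, and that of one vector is the vector itself. -/
def maxCoupling : (k : ℕ) → (Fin k → Fin 3 → ℝ) → ℤ → ℂ
  | 0, _ => unitComp
  | k + 1, a => cgContract k 1 (k + 1) (maxCoupling k (fun j => a j.castSucc))
      (vecComp (a (Fin.last k)))

/-- The self-coupling `a^{⊗̃ k}`. -/
def selfCoupling (k : ℕ) (a : Fin 3 → ℝ) : ℤ → ℂ := maxCoupling k (fun _ => a)

/-- The maximal coupling `(r₁^{⊗̃ l₁} ⊗̃ ⋯ ⊗̃ r_n^{⊗̃ l_n})_{l₁ + ⋯ + l_n}`, contracted successively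
from the left. -/
def blockCoupling : (n : ℕ) → (Fin n → ℕ) → (Fin n → Fin 3 → ℝ) → ℤ → ℂ
  | 0, _, _ => unitComp
  | n + 1, l, r =>
      cgContract (∑ j : Fin n, l j.castSucc) (l (Fin.last n))
        ((∑ j : Fin n, l j.castSucc) + l (Fin.last n))
        (blockCoupling n (fun j => l j.castSucc) (fun j => r j.castSucc))
        (selfCoupling (l (Fin.last n)) (r (Fin.last n)))

/-- The rotation by the angle `θ` about the `z`-axis. -/
def rotZ (θ : ℝ) : Matrix (Fin 3) (Fin 3) ℝ :=
  !![Real.cos θ, -Real.sin θ, 0; Real.sin θ, Real.cos θ, 0; 0, 0, 1]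

/-- The rotation by the angle `θ` about the `y`-axis. -/
def rotY (θ : ℝ) : Matrix (Fin 3) (Fin 3) ℝ :=
  !![Real.cos θ, 0, Real.sin θ; 0, 1, 0; -Real.sin θ, 0, Real.cos θ]

/-- The rotation with Euler angles `α, β, γ` (in the `z`-`y`-`z` convention). -/
def eulerRotation (α β γ : ℝ) : Matrix (Fin 3) (Fin 3) ℝ := rotZ α * rotY β * rotZ γ

/-- A proper harmonic tensor of angular momentum `L` of `n` input vectors: a function of the inputs
with values in `ℝ^{2 L + 1}` that transforms under rotations by the real Wigner matrices and under
the inversion by the sign `(-1) ^ L`. -/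
structure IsProperHarmonicTensor {n L : ℕ} (T : (Fin n → Fin 3 → ℝ) → MIdx L → ℝ) : Prop where
  rotation : ∀ (α β γ : ℝ) (r : Fin n → Fin 3 → ℝ) (μ : MIdx L),
    (T (fun i => (eulerRotation α β γ).mulVec (r i)) μ : ℂ)
      = ∑ μ' : MIdx L, realWignerD L α β γ μ μ' * (T r μ' : ℂ)
  inversion : ∀ (r : Fin n → Fin 3 → ℝ) (μ : MIdx L),
    T (fun i => -r i) μ = (-1 : ℝ) ^ L * T r μ

/-- A scalar function of the inputs: it is invariant under `O(3)`. -/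
def IsScalarFunction {n : ℕ} (f : (Fin n → Fin 3 → ℝ) → ℝ) : Prop :=
  ∀ Q ∈ Matrix.orthogonalGroup (Fin 3) ℝ, ∀ r : Fin n → Fin 3 → ℝ,
    f (fun i => Q.mulVec (r i)) = f r

end

/-! ### The change of basis to the real spherical harmonics -/

/-! Components of degree `l` are encoded as binary forms of degree `2l` on ℂ², the spinor model of
the spin-`l` representation. Three facts make this useful. Coupling to the highest degree becomes
multiplication of functions (`spinorForm_cgContract`), Wigner matrices become substitutions of the
variables (`spinorForm_realWignerD`), and a vector `a` becomes a quadratic form `vecForm a` that is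
linear in `a`. Hence both kinds of couplings turn into monomials of degree `L` in the quadratic
forms of the inputs. What remains is to show that the form of `T r` lies in the `L`-th power of the
span of these quadratic forms (`tensorForm_mem`).

This is a pointwise statement, and it follows from the symmetry of `T` under the stabilizer of `r`
in O(3). If the inputs span ℝ³, then u², uv, v² are all available and generate every form of degree
`2L`. If they span a plane, rotated to z = 0, the reflection in that plane fixes them and removes
exactly the monomials that are not products of u² and v². If they span a line, rotated to the
z-axis, the rotations about it leave only (uv)^L. If all inputs vanish, full rotation invariance
leaves nothing unless `L = 0`.

The complex coefficients so obtained may be replaced by their real parts, because the couplings are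
real; this is read off from the quaternionic structure on ℂ² (`conj_eq_self_of_spinorForm_eq_prod`).
Finally the coefficients are chosen at one representative of each O(3)-orbit and kept constant along
the orbit. The expansion carries over because an orthogonal map acts on both sides by the same
substitution and the same sign (`exists_scalar_expansion`). -/

theorem realHarmonicCoeff_eq_zero {μ m : ℤ} (h₁ : m ≠ μ) (h₂ : m ≠ -μ) :
    realHarmonicCoeff μ m = 0 := by
  unfold realHarmonicCoeff
  split_ifs <;> simp_all

theorem realHarmonicCoeff_zero_zero : realHarmonicCoeff 0 0 = 1 := by
  simp [realHarmonicCoeff]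

theorem realHarmonicCoeff_neg_neg {k : ℤ} (hk : 0 < k) :
    realHarmonicCoeff (-k) (-k) = 1 / (Real.sqrt 2 : ℂ) := by
  simp [realHarmonicCoeff, hk, hk.ne']

theorem realHarmonicCoeff_neg_pos {k : ℤ} (hk : 0 < k) :
    realHarmonicCoeff (-k) k = (-1) ^ k.natAbs / (Real.sqrt 2 : ℂ) := by
  have : k ≠ -k := by omega
  simp [realHarmonicCoeff, hk, hk.ne', this]

theorem realHarmonicCoeff_pos_neg {k : ℤ} (hk : 0 < k) :
    realHarmonicCoeff k (-k) = Complex.I / (Real.sqrt 2 : ℂ) := by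
  simp [realHarmonicCoeff, hk.le, hk.ne', not_lt.mpr]

theorem realHarmonicCoeff_pos_pos {k : ℤ} (hk : 0 < k) :
    realHarmonicCoeff k k = -(Complex.I * (-1) ^ k.natAbs / (Real.sqrt 2 : ℂ)) := by
  have : k ≠ -k := by omega
  simp [realHarmonicCoeff, hk.le, hk.ne', this, not_lt.mpr]

theorem inv_sqrt_two_mul_self :
    ((Real.sqrt 2 : ℂ))⁻¹ * ((Real.sqrt 2 : ℂ))⁻¹ = 1 / 2 := by
  rw [← mul_inv, ← Complex.ofReal_mul, Real.mul_self_sqrt (by norm_num)]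
  norm_num

theorem neg_one_pow_mul_self (k : ℕ) : ((-1 : ℂ) ^ k) * ((-1 : ℂ) ^ k) = 1 := by
  rw [← mul_pow]; norm_num

theorem sum_Icc_eq_pair {l : ℕ} {m : ℤ} (hm : m ∈ Finset.Icc (-(l : ℤ)) l) (hm0 : m ≠ 0)
    {f : ℤ → ℂ} (hf : ∀ μ, μ ≠ m → μ ≠ -m → f μ = 0) :
    ∑ μ ∈ Finset.Icc (-(l : ℤ)) l, f μ = f m + f (-m) := by
  rw [← Finset.sum_pair (show m ≠ -m by omega)]
  symm
  refine Finset.sum_subset ?_ ?_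
  · intro x hx
    simp only [Finset.mem_insert, Finset.mem_singleton, Finset.mem_Icc] at *
    omega
  · intro x _ hx
    simp only [Finset.mem_insert, Finset.mem_singleton, not_or] at hx
    exact hf x hx.1 hx.2

theorem sum_conj_realHarmonicCoeff_mul {l : ℕ} {m m' : ℤ} (hm : m ∈ Finset.Icc (-(l : ℤ)) l) :
    ∑ μ ∈ Finset.Icc (-(l : ℤ)) l,
      (starRingEnd ℂ) (realHarmonicCoeff μ m) * realHarmonicCoeff μ m'
      = if m' = m then 1 else 0 := by
  by_cases hm0 : m = 0
  · subst hm0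
    rw [Finset.sum_eq_single 0]
    · split_ifs with h
      · subst h; simp [realHarmonicCoeff_zero_zero]
      · rw [realHarmonicCoeff_eq_zero (μ := 0) (m := m') h (by simpa using h), mul_zero]
    · intro b _ hb
      rw [realHarmonicCoeff_eq_zero (μ := b) (m := 0) (by omega) (by omega)]; simp
    · intro h; exact absurd hm h
  rw [sum_Icc_eq_pair hm hm0]
  swap
  · intro μ h1 h2
    rw [realHarmonicCoeff_eq_zero (μ := μ) (m := m) (by omega) (by omega)]; simp
  by_cases h1 : m' = m ∨ m' = -m
  swap
  · push Not at h1
    rw [realHarmonicCoeff_eq_zero (μ := m) (m := m') h1.1 h1.2,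
      realHarmonicCoeff_eq_zero (μ := -m) (m := m') h1.2 (by simpa using h1.1), if_neg h1.1]
    simp
  -- With `k = |m|` the closed values apply, and what remains are the four entries of a 2×2 unitary
  -- block.
  obtain ⟨k, hk, hmk⟩ : ∃ k : ℤ, 0 < k ∧ (m = k ∨ m = -k) := by
    rcases lt_or_gt_of_ne hm0 with h | h
    · exact ⟨-m, by omega, by simp⟩
    · exact ⟨m, h, by simp⟩
  have e := inv_sqrt_two_mul_self
  have e2 := neg_one_pow_mul_self k.natAbs
  have e3 := Complex.I_mul_I
  have n1 : k ≠ -k := by omega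
  have n2 : -k ≠ k := by omega
  rcases h1 with rfl | rfl <;> rcases hmk with h | h <;>
    simp only [h, neg_neg, realHarmonicCoeff_neg_neg hk, realHarmonicCoeff_neg_pos hk,
      realHarmonicCoeff_pos_neg hk, realHarmonicCoeff_pos_pos hk, map_inv₀, map_mul, map_neg,
      map_pow, Complex.conj_I, Complex.conj_ofReal, map_one, n1, n2, if_true, if_false,
      div_eq_mul_inv, one_mul]
  · linear_combination ((-1)^k.natAbs*(-1)^k.natAbs) * (1 - Complex.I*Complex.I) * e
      + (1 - Complex.I * Complex.I) / 2 * e2 - 1/2 * e3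
  · linear_combination (1 - Complex.I*Complex.I) * e - 1/2 * e3
  · linear_combination ((-1)^k.natAbs) * (1 + Complex.I*Complex.I) * e
      + ((-1)^k.natAbs)/2 * e3
  · linear_combination ((-1)^k.natAbs) * (1 + Complex.I*Complex.I) * e
      + ((-1)^k.natAbs)/2 * e3

theorem sum_realHarmonicCoeff_mul_conj {l : ℕ} {μ μ' : ℤ} (hμ : μ ∈ Finset.Icc (-(l : ℤ)) l)
    (hμ' : μ' ∈ Finset.Icc (-(l : ℤ)) l) :
    ∑ m ∈ Finset.Icc (-(l : ℤ)) l,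
      realHarmonicCoeff μ m * (starRingEnd ℂ) (realHarmonicCoeff μ' m)
      = if μ = μ' then 1 else 0 := by
  let A : Matrix (MIdx l) (MIdx l) ℂ := fun m μ => (starRingEnd ℂ) (realHarmonicCoeff μ m)
  let B : Matrix (MIdx l) (MIdx l) ℂ := fun μ m => realHarmonicCoeff μ m
  have hAB : A * B = 1 := by
    ext m m'
    rw [Matrix.mul_apply, Matrix.one_apply]
    rw [Finset.sum_coe_sort (Finset.Icc (-(l : ℤ)) l)
      (fun μ => (starRingEnd ℂ) (realHarmonicCoeff μ m) * realHarmonicCoeff μ m'),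
      sum_conj_realHarmonicCoeff_mul m.2]
    simp only [Subtype.ext_iff, eq_comm]
  have hBA := mul_eq_one_comm.mp hAB
  have := congrFun (congrFun hBA ⟨μ, hμ⟩) ⟨μ', hμ'⟩
  rw [Matrix.mul_apply, Matrix.one_apply] at this
  rw [Finset.sum_coe_sort (Finset.Icc (-(l : ℤ)) l)
    (fun m => realHarmonicCoeff μ m * (starRingEnd ℂ) (realHarmonicCoeff μ' m))] at this
  simpa [Subtype.ext_iff] using this

/-- Since the conjugate of `Y_l^m` is `(-1)^m Y_l^{-m}`, this symmetry of the coefficients says that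
the real harmonics are real. -/
theorem conj_realHarmonicCoeff_neg (μ m : ℤ) :
    (-1) ^ m.natAbs * (starRingEnd ℂ) (realHarmonicCoeff μ (-m)) = realHarmonicCoeff μ m := by
  by_cases h1 : m = μ ∨ m = -μ
  swap
  · push Not at h1
    rw [realHarmonicCoeff_eq_zero h1.1 h1.2, realHarmonicCoeff_eq_zero (by omega) (by omega)]
    simp
  rcases lt_trichotomy μ 0 with h | h | h
  · obtain ⟨k, rfl⟩ : ∃ k, μ = -k := ⟨-μ, by simp⟩
    have hk : 0 < k := by omega
    rcases h1 with rfl | rfl <;>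
    simp only [neg_neg, realHarmonicCoeff_neg_neg hk, realHarmonicCoeff_neg_pos hk, map_div₀,
      map_pow, map_neg, map_one, Complex.conj_ofReal, Int.natAbs_neg]
    · rw [← mul_div_assoc, neg_one_pow_mul_self]
    · ring
  · subst h
    have : m = 0 := by omega
    subst this
    simp [realHarmonicCoeff_zero_zero]
  · rcases h1 with rfl | rfl <;>
    simp only [neg_neg, realHarmonicCoeff_pos_neg h, realHarmonicCoeff_pos_pos h, map_div₀,
      map_mul, map_pow, map_neg, map_one, Complex.conj_ofReal, Int.natAbs_neg, Complex.conj_I]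
    · ring
    · linear_combination Complex.I / (Real.sqrt 2 : ℂ) * neg_one_pow_mul_self μ.natAbs

/-! ### Binary forms attached to harmonic components -/

/-- The basis form `√((2l)! / ((l+m)! (l-m)!)) u^(l+m) v^(l-m)` of degree `2l`. -/
noncomputable def spinorBasis (l : ℕ) (m : ℤ) (w : ℂ × ℂ) : ℂ :=
  ((√(zfact (2 * l)) / (√(zfact (l + m)) * √(zfact (l - m))) : ℝ) : ℂ)
    * w.1 ^ (l + m).toNat * w.2 ^ (l - m).toNat

/-- The form of degree `2l` attached to the real spherical harmonic of index `μ`. -/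
noncomputable def harmonicForm (l : ℕ) (μ : ℤ) (w : ℂ × ℂ) : ℂ :=
  ∑ m ∈ Finset.Icc (-(l : ℤ)) l, realHarmonicCoeff μ m * spinorBasis l m w

/-- The form of degree `2l` attached to a family of harmonic components of degree `l`. -/
noncomputable def spinorForm (l : ℕ) (A : ℤ → ℂ) (w : ℂ × ℂ) : ℂ :=
  ∑ μ ∈ Finset.Icc (-(l : ℤ)) l, A μ * harmonicForm l μ w

/-- The components, in the complex basis, of a family of components in the real basis. -/
noncomputable def complexComp (l : ℕ) (A : ℤ → ℂ) (m : ℤ) : ℂ :=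
  ∑ μ ∈ Finset.Icc (-(l : ℤ)) l, A μ * realHarmonicCoeff μ m

theorem zfact_pos (z : ℤ) : 0 < zfact z := by
  unfold zfact; positivity

theorem zfact_natCast (n : ℕ) : zfact n = (n ! : ℝ) := by
  simp [zfact]

theorem invFact_of_neg {z : ℤ} (h : z < 0) : invFact z = 0 := by
  simp [invFact, h]

theorem invFact_of_nonneg {z : ℤ} (h : 0 ≤ z) : invFact z = (zfact z)⁻¹ := by
  simp [invFact, h]

theorem spinorForm_eq (l : ℕ) (A : ℤ → ℂ) (w : ℂ × ℂ) :
    spinorForm l A w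
      = ∑ m ∈ Finset.Icc (-(l : ℤ)) l, complexComp l A m * spinorBasis l m w := by
  simp only [spinorForm, harmonicForm, complexComp, Finset.mul_sum, Finset.sum_mul, mul_assoc]
  exact Finset.sum_comm

theorem sum_conj_mul_harmonicForm {l : ℕ} {m : ℤ} (hm : m ∈ Finset.Icc (-(l : ℤ)) l)
    (w : ℂ × ℂ) :
    ∑ μ ∈ Finset.Icc (-(l : ℤ)) l, (starRingEnd ℂ) (realHarmonicCoeff μ m) * harmonicForm l μ w
      = spinorBasis l m w := by
  simp only [harmonicForm, Finset.mul_sum, ← mul_assoc]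
  rw [Finset.sum_comm]
  simp only [← Finset.sum_mul]
  simp_rw [sum_conj_realHarmonicCoeff_mul hm]
  simp [Finset.sum_ite_eq', Finset.mem_Icc.mp hm]

theorem spinorForm_add (l : ℕ) (A B : ℤ → ℂ) :
    spinorForm l (A + B) = spinorForm l A + spinorForm l B := by
  ext w; simp [spinorForm, add_mul, Finset.sum_add_distrib]

theorem spinorForm_smul (l : ℕ) (c : ℂ) (A : ℤ → ℂ) :
    spinorForm l (c • A) = c • spinorForm l A := by
  ext w; simp [spinorForm, Finset.mul_sum, mul_assoc]

theorem spinorForm_congr {l : ℕ} {A B : ℤ → ℂ} (h : ∀ μ ∈ Finset.Icc (-(l : ℤ)) l, A μ = B μ) :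
    spinorForm l A = spinorForm l B := by
  ext w; exact Finset.sum_congr rfl fun μ hμ => by rw [h μ hμ]

/-- The forms of degree `2l` in the complex basis are linearly independent. -/
theorem eq_zero_of_sum_spinorBasis {l : ℕ} {X : ℤ → ℂ}
    (h : ∀ w, ∑ m ∈ Finset.Icc (-(l : ℤ)) l, X m * spinorBasis l m w = 0) :
    ∀ m ∈ Finset.Icc (-(l : ℤ)) l, X m = 0 := by
  let k : ℤ → ℂ := fun m => ((√(zfact (2 * l)) / (√(zfact (l + m)) * √(zfact (l - m))) : ℝ) : ℂ)
  -- Setting the second variable to 1 gives a polynomial in one variable whose exponents `l + m` are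
  -- distinct.
  let p : Polynomial ℂ :=
    ∑ m ∈ Finset.Icc (-(l : ℤ)) l, Polynomial.C (X m * k m) * Polynomial.X ^ (l + m).toNat
  have hp : p = 0 := by
    refine Polynomial.funext fun t => ?_
    have := h (t, 1)
    simp only [spinorBasis, one_pow, mul_one] at this
    simp only [p, Polynomial.eval_finsetSum, Polynomial.eval_mul, Polynomial.eval_C,
      Polynomial.eval_pow, Polynomial.eval_X, Polynomial.eval_zero]
    rw [← this]
    exact Finset.sum_congr rfl fun m _ => by simp only [k]; ring
  intro m hm
  have hc : p.coeff (l + m).toNat = X m * k m := by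
    simp only [p, Polynomial.finsetSum_coeff, Polynomial.coeff_C_mul, Polynomial.coeff_X_pow]
    rw [Finset.sum_eq_single m]
    · simp
    · intro b hb hbm
      rw [if_neg, mul_zero]
      rw [Finset.mem_Icc] at hb hm
      omega
    · intro h; exact absurd hm h
  rw [hp, Polynomial.coeff_zero] at hc
  have hk : k m ≠ 0 := by
    simp only [k]
    have h1 := Real.sqrt_pos.mpr (zfact_pos (2 * l))
    have h2 := Real.sqrt_pos.mpr (zfact_pos (l + m))
    have h3 := Real.sqrt_pos.mpr (zfact_pos (l - m))
    exact_mod_cast (div_pos h1 (mul_pos h2 h3)).ne'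
  exact (mul_eq_zero.mp hc.symm).resolve_right hk

theorem eq_zero_of_spinorForm {l : ℕ} {A : ℤ → ℂ} (h : spinorForm l A = 0) :
    ∀ μ ∈ Finset.Icc (-(l : ℤ)) l, A μ = 0 := by
  have h1 := eq_zero_of_sum_spinorBasis (l := l) (X := complexComp l A)
    (fun w => by rw [← spinorForm_eq, h]; rfl)
  intro μ hμ
  have h2 : ∑ m ∈ Finset.Icc (-(l : ℤ)) l,
      complexComp l A m * (starRingEnd ℂ) (realHarmonicCoeff μ m) = 0 :=
    Finset.sum_eq_zero fun m hm => by rw [h1 m hm, zero_mul]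
  simp only [complexComp, Finset.sum_mul, mul_assoc] at h2
  rw [Finset.sum_comm] at h2
  simp only [← Finset.mul_sum] at h2
  rw [Finset.sum_congr rfl fun μ' hμ' => by rw [sum_realHarmonicCoeff_mul_conj hμ' hμ]] at h2
  simpa [Finset.mem_Icc.mp hμ] using h2

theorem eq_of_spinorForm_eq {l : ℕ} {A B : ℤ → ℂ} (h : spinorForm l A = spinorForm l B) :
    ∀ μ ∈ Finset.Icc (-(l : ℤ)) l, A μ = B μ := by
  intro μ hμ
  have h1 : spinorForm l (A + (-1 : ℂ) • B) = 0 := by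
    rw [spinorForm_add, spinorForm_smul, h]; simp
  have := eq_zero_of_spinorForm h1 μ hμ
  simpa [← sub_eq_add_neg, sub_eq_zero] using this

/-! ### Coupling to the highest degree is multiplication of forms -/

/-- At `L = l₁ + l₂` the factor `1 / (l₁ + l₂ - L - k)!` is `1 / (-k)!`, so only `k = 0` survives in
Racah's sum. -/
theorem clebschGordan_top (l₁ l₂ : ℕ) {m₁ m₂ : ℤ} (h₁ : m₁ ∈ Finset.Icc (-(l₁ : ℤ)) l₁)
    (h₂ : m₂ ∈ Finset.Icc (-(l₂ : ℤ)) l₂) :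
    clebschGordan l₁ l₂ (l₁ + l₂) m₁ m₂ (m₁ + m₂)
      = √(zfact (2 * l₁)) * √(zfact (2 * l₂)) / √(zfact (2 * (l₁ + l₂)))
        * (√(zfact (l₁ + l₂ + (m₁ + m₂))) * √(zfact (l₁ + l₂ - (m₁ + m₂))))
        / (√(zfact (l₁ + m₁)) * √(zfact (l₁ - m₁)) * √(zfact (l₂ + m₂)) * √(zfact (l₂ - m₂))) := by
  rw [Finset.mem_Icc] at h₁ h₂
  have hsum : ∑ k ∈ Finset.range (l₁ + l₂ + 1), (-1 : ℝ) ^ k * invFact k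
      * invFact (l₁ + l₂ - (l₁ + l₂ : ℕ) - k)
      * invFact (l₁ - m₁ - k) * invFact (l₂ + m₂ - k)
      * invFact ((l₁ + l₂ : ℕ) - l₂ + m₁ + k) * invFact ((l₁ + l₂ : ℕ) - l₁ - m₂ + k)
      = (zfact (l₁ - m₁))⁻¹ * (zfact (l₂ + m₂))⁻¹ * (zfact (l₁ + m₁))⁻¹ * (zfact (l₂ - m₂))⁻¹ := by
    rw [Finset.sum_eq_single 0]
    · rw [← invFact_of_nonneg (z := l₁ - m₁) (by omega),
        ← invFact_of_nonneg (z := l₂ + m₂) (by omega),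
        ← invFact_of_nonneg (z := l₁ + m₁) (by omega),
        ← invFact_of_nonneg (z := l₂ - m₂) (by omega)]
      have e0 : invFact 0 = 1 := by simp [invFact, zfact]
      simp [e0]
    · intro b _ hb
      rw [invFact_of_neg (z := l₁ + l₂ - (l₁ + l₂ : ℕ) - b) (by push_cast; omega)]
      simp
    · simp
  unfold clebschGordan
  rw [if_pos rfl, hsum]
  have f1 : zfact ((l₁ + l₂ : ℕ) + l₁ - l₂) = zfact (2 * l₁) := by congr 1; push_cast; ring
  have f2 : zfact ((l₁ + l₂ : ℕ) - l₁ + l₂) = zfact (2 * l₂) := by congr 1; push_cast; ring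
  have f3 : zfact (l₁ + l₂ - (l₁ + l₂ : ℕ)) = 1 := by simp [zfact]
  have f4 : zfact (l₁ + l₂ + (l₁ + l₂ : ℕ) + 1)
      = (2 * (l₁ + l₂ : ℕ) + 1) * zfact (2 * (l₁ + l₂)) := by
    have e1 : (l₁ + l₂ + (l₁ + l₂ : ℕ) + 1 : ℤ) = ((2 * (l₁ + l₂) + 1 : ℕ) : ℤ) := by
      push_cast; ring
    have e2 : (2 * (l₁ + l₂) : ℤ) = ((2 * (l₁ + l₂) : ℕ) : ℤ) := by push_cast; ring
    rw [e1, e2, zfact_natCast, zfact_natCast, Nat.factorial_succ]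
    push_cast; ring
  have e5 : ((l₁ + l₂ : ℕ) : ℤ) = l₁ + l₂ := by push_cast; ring
  rw [f1, f2, f3, f4, e5]
  have hp : ((2 * (l₁ + l₂ : ℕ) + 1 : ℝ)) ≠ 0 := by positivity
  have g : (2 * (l₁ + l₂ : ℕ) + 1 : ℝ) * zfact (2 * l₁) * zfact (2 * l₂) * 1
      / ((2 * (l₁ + l₂ : ℕ) + 1) * zfact (2 * (l₁ + l₂)))
      = zfact (2 * l₁) * zfact (2 * l₂) / zfact (2 * (l₁ + l₂)) := by
    rw [mul_one, mul_assoc, mul_div_mul_left _ _ hp]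
  rw [g]
  have z := fun x => (zfact_pos x).le
  have zs := fun x => Real.mul_self_sqrt (z x)
  rw [Real.sqrt_div (mul_nonneg (z _) (z _)), Real.sqrt_mul (z _)]
  rw [Real.sqrt_mul' _ (z (l₂ + m₂)), Real.sqrt_mul' _ (z (l₂ - m₂)), Real.sqrt_mul' _ (z (l₁ + m₁)),
    Real.sqrt_mul' _ (z (l₁ - m₁)), Real.sqrt_mul (z _)]
  have s1 := fun x => Real.sqrt_pos.mpr (zfact_pos x)
  have i := fun x : ℤ => (show (zfact x)⁻¹ = (√(zfact x))⁻¹ * (√(zfact x))⁻¹ by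
    rw [← mul_inv, zs])
  rw [i (l₁ - m₁), i (l₂ + m₂), i (l₁ + m₁), i (l₂ - m₂)]
  have n1 := (s1 (l₁ - m₁)).ne'
  have n2 := (s1 (l₁ + m₁)).ne'
  have n3 := (s1 (l₂ - m₂)).ne'
  have n4 := (s1 (l₂ + m₂)).ne'
  field_simp

/-- The normalization of `spinorBasis` is such that the top coefficient is exactly the quotient of
the normalizing constants, while the exponents of the monomials add. -/
theorem clebschGordan_top_mul_spinorBasis (l₁ l₂ : ℕ) {m₁ m₂ : ℤ}
    (h₁ : m₁ ∈ Finset.Icc (-(l₁ : ℤ)) l₁) (h₂ : m₂ ∈ Finset.Icc (-(l₂ : ℤ)) l₂) (w : ℂ × ℂ) :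
    (clebschGordan l₁ l₂ (l₁ + l₂) m₁ m₂ (m₁ + m₂) : ℂ) * spinorBasis (l₁ + l₂) (m₁ + m₂) w
      = spinorBasis l₁ m₁ w * spinorBasis l₂ m₂ w := by
  rw [clebschGordan_top l₁ l₂ h₁ h₂]
  rw [Finset.mem_Icc] at h₁ h₂
  unfold spinorBasis
  have e1 : (((l₁ + l₂ : ℕ) : ℤ) + (m₁ + m₂)).toNat = (l₁ + m₁).toNat + (l₂ + m₂).toNat := by omega
  have e2 : (((l₁ + l₂ : ℕ) : ℤ) - (m₁ + m₂)).toNat = (l₁ - m₁).toNat + (l₂ - m₂).toNat := by omega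
  rw [e1, e2, pow_add, pow_add]
  have e5 : ((l₁ + l₂ : ℕ) : ℤ) = l₁ + l₂ := by push_cast; ring
  rw [e5]
  have s1 := fun x => (Real.sqrt_pos.mpr (zfact_pos x)).ne'
  have key : ∀ a b c d e f a1 b1 c1 d1 : ℝ, c ≠ 0 → d ≠ 0 → e ≠ 0 →
      a * b / c * (d * e) / (a1 * b1 * c1 * d1) * (c / (d * e))
        = a / (a1 * b1) * (b / (c1 * d1)) := by
    intro a b c d e f a1 b1 c1 d1 hc hd he
    field_simp
  have := key (√(zfact (2 * l₁))) (√(zfact (2 * l₂))) (√(zfact (2 * (l₁ + l₂))))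
    (√(zfact (l₁ + l₂ + (m₁ + m₂)))) (√(zfact (l₁ + l₂ - (m₁ + m₂)))) 0 (√(zfact (l₁ + m₁)))
    (√(zfact (l₁ - m₁))) (√(zfact (l₂ + m₂))) (√(zfact (l₂ - m₂))) (s1 _) (s1 _) (s1 _)
  have := congrArg (fun x : ℝ => (x : ℂ)) this
  simp only [Complex.ofReal_mul _ (√(zfact (2 * (l₁ + l₂))) / _)] at this
  rw [Complex.ofReal_mul (_ / (_ * _))] at this
  linear_combination (w.1 ^ (l₁ + m₁).toNat * w.1 ^ (l₂ + m₂).toNat *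
    (w.2 ^ (l₁ - m₁).toNat * w.2 ^ (l₂ - m₂).toNat)) * this

/-- Unitarity of the change of basis cancels the outer real harmonic coefficients, which leaves the
product rule for the complex basis forms. Maximal coupling is thereby commutative and associative at
the level of forms. -/
theorem spinorForm_cgContract (l₁ l₂ : ℕ) (A B : ℤ → ℂ) :
    spinorForm (l₁ + l₂) (cgContract l₁ l₂ (l₁ + l₂) A B) = spinorForm l₁ A * spinorForm l₂ B := by
  ext w
  have h1 : ∀ μ₁ μ₂ : ℤ, ∑ μ ∈ Finset.Icc (-((l₁ + l₂ : ℕ) : ℤ)) (l₁ + l₂ : ℕ),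
      realClebschGordan l₁ l₂ (l₁ + l₂) μ₁ μ₂ μ * harmonicForm (l₁ + l₂) μ w
      = harmonicForm l₁ μ₁ w * harmonicForm l₂ μ₂ w := by
    intro μ₁ μ₂
    simp only [realClebschGordan, Finset.sum_mul]
    rw [Finset.sum_comm]
    have h2 : ∀ m ∈ Finset.Icc (-((l₁ + l₂ : ℕ) : ℤ)) (l₁ + l₂ : ℕ),
        (∑ μ ∈ Finset.Icc (-((l₁ + l₂ : ℕ) : ℤ)) (l₁ + l₂ : ℕ),
          ∑ m₁ ∈ Finset.Icc (-(l₁ : ℤ)) l₁, ∑ m₂ ∈ Finset.Icc (-(l₂ : ℤ)) l₂,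
            (starRingEnd ℂ) (realHarmonicCoeff μ m) * (clebschGordan l₁ l₂ (l₁ + l₂) m₁ m₂ m : ℂ)
              * realHarmonicCoeff μ₁ m₁ * realHarmonicCoeff μ₂ m₂ * harmonicForm (l₁ + l₂) μ w)
        = ∑ m₁ ∈ Finset.Icc (-(l₁ : ℤ)) l₁, ∑ m₂ ∈ Finset.Icc (-(l₂ : ℤ)) l₂,
            (clebschGordan l₁ l₂ (l₁ + l₂) m₁ m₂ m : ℂ)
              * realHarmonicCoeff μ₁ m₁ * realHarmonicCoeff μ₂ m₂ * spinorBasis (l₁ + l₂) m w := by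
      intro m hm
      rw [Finset.sum_comm]
      refine Finset.sum_congr rfl fun m₁ _ => ?_
      rw [Finset.sum_comm]
      refine Finset.sum_congr rfl fun m₂ _ => ?_
      rw [← sum_conj_mul_harmonicForm hm, Finset.mul_sum]
      exact Finset.sum_congr rfl fun μ _ => by ring
    rw [Finset.sum_congr rfl h2, Finset.sum_comm]
    simp only [harmonicForm, Finset.sum_mul_sum]
    refine Finset.sum_congr rfl fun m₁ hm₁ => ?_
    rw [Finset.sum_comm]
    refine Finset.sum_congr rfl fun m₂ hm₂ => ?_
    rw [Finset.sum_eq_single (m₁ + m₂)]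
    · linear_combination realHarmonicCoeff μ₁ m₁ * realHarmonicCoeff μ₂ m₂
        * clebschGordan_top_mul_spinorBasis l₁ l₂ hm₁ hm₂ w
    · intro m _ hm
      simp [clebschGordan, hm.symm]
    · intro h
      rw [Finset.mem_Icc] at *
      push_cast at h
      omega
  simp only [spinorForm, cgContract, Pi.mul_apply]
  rw [Finset.sum_mul_sum]
  simp only [Finset.sum_mul]
  rw [Finset.sum_comm]
  refine Finset.sum_congr rfl fun μ₁ _ => ?_
  rw [Finset.sum_comm]
  refine Finset.sum_congr rfl fun μ₂ _ => ?_
  rw [show A μ₁ * harmonicForm l₁ μ₁ w * (B μ₂ * harmonicForm l₂ μ₂ w)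
    = A μ₁ * B μ₂ * (harmonicForm l₁ μ₁ w * harmonicForm l₂ μ₂ w) by ring, ← h1, Finset.mul_sum]
  exact Finset.sum_congr rfl fun μ _ => by ring

/-! ### Wigner matrices act by substitution -/

/-- The substitution corresponding to the rotation about the `z`-axis. -/
noncomputable def spinorZ (α : ℝ) (w : ℂ × ℂ) : ℂ × ℂ :=
  (Complex.exp (-(Complex.I * α / 2)) * w.1, Complex.exp (Complex.I * α / 2) * w.2)

/-- The substitution corresponding to the rotation about the `y`-axis. -/
noncomputable def spinorY (β : ℝ) (w : ℂ × ℂ) : ℂ × ℂ :=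
  ((Real.cos (β / 2) : ℂ) * w.1 + (Real.sin (β / 2) : ℂ) * w.2,
    -(Real.sin (β / 2) : ℂ) * w.1 + (Real.cos (β / 2) : ℂ) * w.2)

/-- The substitution corresponding to the rotation with given Euler angles. -/
noncomputable def spinorRotation (α β γ : ℝ) (w : ℂ × ℂ) : ℂ × ℂ :=
  spinorZ γ (spinorY β (spinorZ α w))

theorem spinorBasis_spinorZ {l : ℕ} {m : ℤ} (hm : m ∈ Finset.Icc (-(l : ℤ)) l) (α : ℝ)
    (w : ℂ × ℂ) :
    spinorBasis l m (spinorZ α w) = Complex.exp (-(Complex.I * m * α)) * spinorBasis l m w := by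
  rw [Finset.mem_Icc] at hm
  simp only [spinorBasis, spinorZ, mul_pow, ← Complex.exp_nat_mul]
  have h1 : (((l + m).toNat : ℕ) : ℂ) = l + m := by
    have : (((l + m).toNat : ℕ) : ℤ) = l + m := by omega
    exact_mod_cast this
  have h2 : (((l - m).toNat : ℕ) : ℂ) = l - m := by
    have : (((l - m).toNat : ℕ) : ℤ) = l - m := by omega
    exact_mod_cast this
  rw [h1, h2]
  have h3 : Complex.exp (-(Complex.I * m * α)) = Complex.exp ((l + m) * -(Complex.I * α / 2))
      * Complex.exp ((l - m) * (Complex.I * α / 2)) := by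
    rw [← Complex.exp_add]; congr 1; ring
  rw [h3]; ring

theorem add_pow_mul_add_pow (p q : ℕ) (c s u v : ℂ) :
    (c * u + s * v) ^ p * (-s * u + c * v) ^ q
      = ∑ a ∈ Finset.range (p + 1), ∑ b ∈ Finset.range (q + 1),
        (-1) ^ b * ((p.choose a : ℂ) * (q.choose b : ℂ)) * c ^ (p - a + (q - b)) * s ^ (a + b)
          * u ^ (p - a + b) * v ^ (a + (q - b)) := by
  rw [add_comm (c * u), add_pow, add_pow, Finset.sum_mul_sum]
  refine Finset.sum_congr rfl fun a _ => Finset.sum_congr rfl fun b _ => ?_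
  simp only [mul_pow, pow_add, neg_mul, neg_pow (s * u)]
  ring

/-- Wigner's closed formula collects the coefficients in the binomial expansion of `(cu + sv)^(l+m')
(-su + cv)^(l-m')`; his summation index counts the factors `sv` taken from the first power. -/
theorem sum_wignerSmallD_mul_spinorBasis {l : ℕ} {m' : ℤ} (hm' : m' ∈ Finset.Icc (-(l : ℤ)) l)
    (β : ℝ) (w : ℂ × ℂ) :
    ∑ m ∈ Finset.Icc (-(l : ℤ)) l, (wignerSmallD l β m m' : ℂ) * spinorBasis l m w
      = spinorBasis l m' (spinorY β w) := by
  rw [Finset.mem_Icc] at hm'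
  obtain ⟨p, hp⟩ : ∃ p : ℕ, (p : ℤ) = l + m' := ⟨(l + m').toNat, by omega⟩
  obtain ⟨q, hq⟩ : ∃ q : ℕ, (q : ℤ) = l - m' := ⟨(l - m').toNat, by omega⟩
  have s1 := fun x => (Real.sqrt_pos.mpr (zfact_pos x)).ne'
  set c := Real.cos (β / 2) with hc
  set s := Real.sin (β / 2) with hs
  have rhs : spinorBasis l m' (spinorY β w) = ∑ a ∈ Finset.range (p + 1),
      ∑ b ∈ Finset.range (q + 1),
      ((√(zfact (2 * l)) / (√(p ! : ℝ) * √(q ! : ℝ)) : ℝ) : ℂ) *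
      ((-1) ^ b * ((p.choose a : ℂ) * (q.choose b : ℂ)) * (c : ℂ) ^ (p - a + (q - b))
        * (s : ℂ) ^ (a + b) * w.1 ^ (p - a + b) * w.2 ^ (a + (q - b))) := by
    simp only [← Finset.mul_sum]
    rw [← add_pow_mul_add_pow]
    simp only [spinorBasis, spinorY, ← hp, ← hq, zfact_natCast, Int.toNat_natCast, ← hc, ← hs]
    ring
  have lhs : ∀ m ∈ Finset.Icc (-(l : ℤ)) l,
      (wignerSmallD l β m m' : ℂ) * spinorBasis l m w = ∑ a ∈ Finset.range (2 * l + 1),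
        (((√(zfact (2 * l)) * (√(p ! : ℝ) * √(q ! : ℝ)) *
        ((-1 : ℝ) ^ (m - m' + a).toNat
        * invFact (l + m' - a) * invFact a * invFact (m - m' + a) * invFact (l - m - a)
        * c ^ (2 * l + m' - m - 2 * a).toNat
        * s ^ (m - m' + 2 * a).toNat) : ℝ) : ℂ) * w.1 ^ (l + m).toNat * w.2 ^ (l - m).toNat) := by
    intro m hm
    rw [← Finset.sum_mul, ← Finset.sum_mul, ← Complex.ofReal_sum, ← Finset.mul_sum]
    unfold wignerSmallD spinorBasis
    rw [← hp, ← hq, zfact_natCast, zfact_natCast]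
    rw [Real.sqrt_mul' _ (by positivity), Real.sqrt_mul' _ (by positivity),
      Real.sqrt_mul' _ (zfact_pos _).le]
    rw [← mul_assoc, ← mul_assoc, ← Complex.ofReal_mul]
    congr 3
    have n1 := s1 (l + m)
    have n2 := s1 (l - m)
    field_simp
    exact mul_comm _ _
  rw [rhs, Finset.sum_congr rfl lhs, Finset.sum_comm]
  have hsub : Finset.range (p + 1) ⊆ Finset.range (2 * l + 1) := by
    apply Finset.range_subset_range.mpr; omega
  rw [← Finset.sum_subset hsub]
  swap
  · intro a _ ha
    rw [Finset.mem_range] at ha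
    refine Finset.sum_eq_zero fun m _ => ?_
    rw [invFact_of_neg (z := l + m' - a) (by omega)]; simp
  refine Finset.sum_congr rfl fun a ha => ?_
  rw [Finset.mem_range] at ha
  symm
  -- Taking `a` factors `sv` and `b` factors `-su` yields u to the power `l + m' - a + b`, hence `m
  -- = m' - a + b`. For all other `m` a reciprocal factorial vanishes.
  refine Finset.sum_of_injOn (fun b : ℕ => m' - a + b) (fun x _ y _ h => by simpa using h) ?_ ?_ ?_
  · intro b hb
    simp only [Finset.coe_range, Set.mem_Iio, Finset.coe_Icc, Set.mem_Icc] at *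
    omega
  · intro m hm hm2
    have : m - m' + a < 0 ∨ l - m - a < 0 := by
      by_contra! h
      apply hm2
      refine ⟨(m - m' + a).toNat, ?_, ?_⟩
      · simp only [Finset.coe_range, Set.mem_Iio]; omega
      · simp only; omega
    rcases this with h | h <;> rw [invFact_of_neg h] <;> simp
  · intro b hb
    rw [Finset.mem_range] at hb
    have e1 : (l + m' - a : ℤ) = ((p - a : ℕ) : ℤ) := by omega
    have e2 : (m' - a + b - m' + a : ℤ) = (b : ℤ) := by omega
    have e3 : (l - (m' - a + b) - a : ℤ) = ((q - b : ℕ) : ℤ) := by omega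
    have e4 : (2 * l + m' - (m' - a + b) - 2 * a : ℤ) = ((p - a + (q - b) : ℕ) : ℤ) := by omega
    have e5 : (m' - a + b - m' + 2 * a : ℤ) = ((a + b : ℕ) : ℤ) := by omega
    have e6 : (l + (m' - a + b) : ℤ) = ((p - a + b : ℕ) : ℤ) := by omega
    have e7 : (l - (m' - a + b) : ℤ) = ((a + (q - b) : ℕ) : ℤ) := by omega
    rw [e1, e2, e3, e4, e5, e6, e7]
    simp only [invFact_of_nonneg (Int.natCast_nonneg _), zfact_natCast, Int.toNat_natCast]
    rw [Nat.cast_choose ℂ (by omega : a ≤ p), Nat.cast_choose ℂ (by omega : b ≤ q)]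
    have n1 : (p ! : ℝ) = √(p ! : ℝ) * √(p ! : ℝ) := (Real.mul_self_sqrt (by positivity)).symm
    have n2 : (q ! : ℝ) = √(q ! : ℝ) * √(q ! : ℝ) := (Real.mul_self_sqrt (by positivity)).symm
    have m1 : √(p ! : ℝ) ≠ 0 := by positivity
    have m2 : √(q ! : ℝ) ≠ 0 := by positivity
    have n1c : (p ! : ℂ) = (√(p ! : ℝ) : ℂ) * (√(p ! : ℝ) : ℂ) := by
      exact_mod_cast congrArg (fun x : ℝ => (x : ℂ)) n1
    have n2c : (q ! : ℂ) = (√(q ! : ℝ) : ℂ) * (√(q ! : ℝ) : ℂ) := by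
      exact_mod_cast congrArg (fun x : ℝ => (x : ℂ)) n2
    rw [n1c, n2c]
    have m1c : (√(p ! : ℝ) : ℂ) ≠ 0 := by exact_mod_cast m1
    have m2c : (√(q ! : ℝ) : ℂ) ≠ 0 := by exact_mod_cast m2
    push_cast
    have key : ∀ S P Q e x₁ x₂ x₃ x₄ C D U V : ℂ, P ≠ 0 → Q ≠ 0 →
        S / (P * Q) * (e * ((P * P / (x₁ * x₂)) * (Q * Q / (x₃ * x₄))) * C * D * U * V)
          = S * (P * Q) * (e * x₂⁻¹ * x₁⁻¹ * x₃⁻¹ * x₄⁻¹ * C * D) * U * V := by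
      intro S P Q e x₁ x₂ x₃ x₄ C D U V hP hQ
      simp only [div_eq_mul_inv, mul_inv]
      have hp1 := inv_mul_cancel₀ hP
      have hq1 := inv_mul_cancel₀ hQ
      linear_combination S * e * P * Q * Q * Q⁻¹ * x₁⁻¹ * x₂⁻¹ * x₃⁻¹ * x₄⁻¹ * C * D * U * V * hp1
        + S * e * P * Q * x₁⁻¹ * x₂⁻¹ * x₃⁻¹ * x₄⁻¹ * C * D * U * V * hq1
    exact key _ _ _ _ _ _ _ _ _ _ _ _ m1c m2c

theorem sum_wignerD_mul_spinorBasis {l : ℕ} {m' : ℤ} (hm' : m' ∈ Finset.Icc (-(l : ℤ)) l)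
    (α β γ : ℝ) (w : ℂ × ℂ) :
    ∑ m ∈ Finset.Icc (-(l : ℤ)) l, wignerD l α β γ m m' * spinorBasis l m w
      = spinorBasis l m' (spinorRotation α β γ w) := by
  rw [spinorRotation, spinorBasis_spinorZ hm', ← sum_wignerSmallD_mul_spinorBasis hm',
    Finset.mul_sum]
  refine Finset.sum_congr rfl fun m hm => ?_
  rw [spinorBasis_spinorZ hm, wignerD]
  ring

theorem sum_realWignerD_mul_harmonicForm (l : ℕ) (μ' : ℤ) (α β γ : ℝ) (w : ℂ × ℂ) :
    ∑ μ ∈ Finset.Icc (-(l : ℤ)) l, realWignerD l α β γ μ μ' * harmonicForm l μ w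
      = harmonicForm l μ' (spinorRotation α β γ w) := by
  simp only [realWignerD, Finset.sum_mul]
  rw [Finset.sum_comm]
  have h : ∀ m ∈ Finset.Icc (-(l : ℤ)) l, (∑ μ ∈ Finset.Icc (-(l : ℤ)) l,
      ∑ m' ∈ Finset.Icc (-(l : ℤ)) l, (starRingEnd ℂ) (realHarmonicCoeff μ m)
        * wignerD l α β γ m m' * realHarmonicCoeff μ' m' * harmonicForm l μ w)
      = ∑ m' ∈ Finset.Icc (-(l : ℤ)) l,
        wignerD l α β γ m m' * realHarmonicCoeff μ' m' * spinorBasis l m w := by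
    intro m hm
    rw [Finset.sum_comm]
    refine Finset.sum_congr rfl fun m' _ => ?_
    rw [← sum_conj_mul_harmonicForm hm, Finset.mul_sum]
    exact Finset.sum_congr rfl fun μ _ => by ring
  rw [Finset.sum_congr rfl h, Finset.sum_comm]
  simp only [harmonicForm]
  refine Finset.sum_congr rfl fun m' hm' => ?_
  rw [← sum_wignerD_mul_spinorBasis hm', Finset.mul_sum]
  exact Finset.sum_congr rfl fun m _ => by ring

theorem spinorForm_realWignerD (l : ℕ) (A : ℤ → ℂ) (α β γ : ℝ) (w : ℂ × ℂ) :
    spinorForm l (fun μ => ∑ μ' ∈ Finset.Icc (-(l : ℤ)) l, realWignerD l α β γ μ μ' * A μ') w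
      = spinorForm l A (spinorRotation α β γ w) := by
  simp only [spinorForm, Finset.sum_mul]
  rw [Finset.sum_comm]
  refine Finset.sum_congr rfl fun μ' _ => ?_
  rw [← sum_realWignerD_mul_harmonicForm, Finset.mul_sum]
  exact Finset.sum_congr rfl fun μ _ => by ring

/-! ### The real structure -/

/-- The quaternionic structure on spinors. -/
noncomputable def spinorConj (w : ℂ × ℂ) : ℂ × ℂ :=
  (-(starRingEnd ℂ) w.2, (starRingEnd ℂ) w.1)

theorem conj_spinorBasis_spinorConj {l : ℕ} {m : ℤ} (hm : m ∈ Finset.Icc (-(l : ℤ)) l)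
    (w : ℂ × ℂ) :
    (starRingEnd ℂ) (spinorBasis l m (spinorConj w))
      = (-1) ^ l * (-1) ^ m.natAbs * spinorBasis l (-m) w := by
  rw [Finset.mem_Icc] at hm
  have e1 : (l + -m : ℤ) = l - m := by ring
  have e2 : (l - -m : ℤ) = l + m := by ring
  simp only [spinorBasis, spinorConj, e1, e2, map_mul, map_pow, map_neg, Complex.conj_conj,
    Complex.conj_ofReal]
  rw [neg_pow]
  have : ((-1 : ℂ) ^ (l + m).toNat) = (-1) ^ l * (-1) ^ m.natAbs := by
    rw [← pow_add]
    rcases le_or_gt 0 m with h | h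
    · congr 1; omega
    · have : l + m.natAbs = (l + m).toNat + m.natAbs + m.natAbs := by omega
      rw [this, pow_add, pow_add, mul_assoc, neg_one_pow_mul_self, mul_one]
  rw [this, mul_comm (√(zfact (l + m))) (√(zfact (l - m)))]
  ring

theorem conj_harmonicForm_spinorConj (l : ℕ) (μ : ℤ) (w : ℂ × ℂ) :
    (starRingEnd ℂ) (harmonicForm l μ (spinorConj w)) = (-1) ^ l * harmonicForm l μ w := by
  simp only [harmonicForm, map_sum, map_mul, Finset.mul_sum]
  refine Finset.sum_nbij' (fun m => -m) (fun m => -m) ?_ ?_ (by simp) (by simp) ?_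
  · intro m hm; rw [Finset.mem_Icc] at *; omega
  · intro m hm; rw [Finset.mem_Icc] at *; omega
  · intro m hm
    rw [conj_spinorBasis_spinorConj hm, ← conj_realHarmonicCoeff_neg μ (-m), neg_neg,
      Int.natAbs_neg]
    ring

/-- Conjugating the components corresponds to conjugating the form along `spinorConj`, up to
`(-1)^l`. This makes reality of the components a property of the form alone. -/
theorem conj_spinorForm_spinorConj (l : ℕ) (A : ℤ → ℂ) (w : ℂ × ℂ) :
    (starRingEnd ℂ) (spinorForm l A (spinorConj w))
      = (-1) ^ l * spinorForm l (fun μ => (starRingEnd ℂ) (A μ)) w := by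
  simp only [spinorForm, map_sum, map_mul, Finset.mul_sum, conj_harmonicForm_spinorConj]
  exact Finset.sum_congr rfl fun μ _ => by ring

/-! ### Couplings of vectors are products of quadratic forms -/

/-- The quadratic form attached to a vector. -/
noncomputable def vecForm : (Fin 3 → ℝ) →ₗ[ℝ] (ℂ × ℂ → ℂ) where
  toFun a w := (a 0 + a 1 * Complex.I) / (√2 : ℝ) * w.2 ^ 2 + (√2 : ℝ) * a 2 * (w.1 * w.2)
    + (-a 0 + a 1 * Complex.I) / (√2 : ℝ) * w.1 ^ 2
  map_add' a b := by ext w; simp; ring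
  map_smul' c a := by ext w; simp; ring

theorem vecForm_apply (a : Fin 3 → ℝ) (w : ℂ × ℂ) :
    vecForm a w = (a 0 + a 1 * Complex.I) / (√2 : ℝ) * w.2 ^ 2 + (√2 : ℝ) * a 2 * (w.1 * w.2)
      + (-a 0 + a 1 * Complex.I) / (√2 : ℝ) * w.1 ^ 2 := rfl

theorem spinorForm_vecComp (a : Fin 3 → ℝ) : spinorForm 1 (vecComp a) = vecForm a := by
  ext w
  have hI : Finset.Icc (-((1 : ℕ) : ℤ)) (1 : ℕ) = {-1, 0, 1} := by decide
  have h2 : (√2 : ℂ) ≠ 0 := by norm_num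
  have z0 : zfact 0 = 1 := by simp [zfact]
  have z1 : zfact 1 = 1 := by simp [zfact]
  have z2 : zfact 2 = 2 := by simp [zfact]
  simp only [spinorForm, harmonicForm, hI, vecForm_apply]
  simp [vecComp, realHarmonicCoeff, spinorBasis, z0, z1, z2]
  field_simp
  ring

theorem spinorForm_unitComp : spinorForm 0 unitComp = 1 := by
  ext w
  simp [spinorForm, harmonicForm, unitComp, realHarmonicCoeff, spinorBasis, zfact]

theorem spinorForm_maxCoupling (k : ℕ) (a : Fin k → Fin 3 → ℝ) :
    spinorForm k (maxCoupling k a) = ∏ j, vecForm (a j) := by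
  induction k with
  | zero => simpa [maxCoupling] using spinorForm_unitComp
  | succ k ih =>
    rw [maxCoupling, spinorForm_cgContract, ih, spinorForm_vecComp, Fin.prod_univ_castSucc]

theorem spinorForm_selfCoupling (k : ℕ) (a : Fin 3 → ℝ) :
    spinorForm k (selfCoupling k a) = vecForm a ^ k := by
  rw [selfCoupling, spinorForm_maxCoupling]; simp

/-- Only the multiplicities of the inputs matter, so block couplings and successive couplings of
single vectors yield the same monomials. -/
theorem spinorForm_blockCoupling (n : ℕ) (l : Fin n → ℕ) (r : Fin n → Fin 3 → ℝ) :
    spinorForm (∑ j, l j) (blockCoupling n l r) = ∏ j, vecForm (r j) ^ l j := by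
  induction n with
  | zero => simpa [blockCoupling] using spinorForm_unitComp
  | succ n ih =>
    rw [blockCoupling, Fin.sum_univ_castSucc, spinorForm_cgContract, ih, spinorForm_selfCoupling,
      Fin.prod_univ_castSucc]

theorem conj_vecForm_spinorConj (a : Fin 3 → ℝ) (w : ℂ × ℂ) :
    (starRingEnd ℂ) (vecForm a (spinorConj w)) = -vecForm a w := by
  simp only [vecForm_apply, spinorConj, map_add, map_mul, map_div₀, map_neg, map_pow,
    Complex.conj_conj, Complex.conj_ofReal, Complex.conj_I]
  ring

/-- Components whose form is a product of forms of vectors are real. -/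
theorem conj_eq_self_of_spinorForm_eq_prod {n L : ℕ} {A : ℤ → ℂ} {e : Fin n → ℕ}
    {r : Fin n → Fin 3 → ℝ} (he : ∑ j, e j = L)
    (h : spinorForm L A = ∏ j, vecForm (r j) ^ e j) :
    ∀ μ ∈ Finset.Icc (-(L : ℤ)) L, (starRingEnd ℂ) (A μ) = A μ := by
  apply eq_of_spinorForm_eq
  ext w
  have h1 := conj_spinorForm_spinorConj L A w
  rw [h] at h1
  simp only [Finset.prod_apply, Pi.pow_apply, map_prod, map_pow, conj_vecForm_spinorConj] at h1
  -- Each of the `L` quadratic factors contributes a sign -1, and together they cancel the `(-1)^L`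
  -- of the real structure.
  simp only [neg_pow (vecForm _ w), Finset.prod_mul_distrib, Finset.prod_pow_eq_pow_sum, he] at h1
  have h2 : ((-1 : ℂ) ^ L) ≠ 0 := by simp
  rw [h, Finset.prod_apply]
  simp only [Pi.pow_apply]
  exact (mul_left_cancel₀ h2 h1).symm

/-! ### Rotations -/

theorem vecForm_rotZ (α : ℝ) (a : Fin 3 → ℝ) (w : ℂ × ℂ) :
    vecForm ((rotZ α).mulVec a) w = vecForm a (spinorZ α w) := by
  have e1 : Complex.exp (Complex.I * α / 2) ^ 2 = Real.cos α + Real.sin α * Complex.I := by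
    rw [← Complex.exp_nat_mul, Complex.ofReal_cos, Complex.ofReal_sin, ← Complex.exp_mul_I]
    congr 1; push_cast; ring
  have e2 : Complex.exp (-(Complex.I * α / 2)) ^ 2 = Real.cos α - Real.sin α * Complex.I := by
    rw [← Complex.exp_nat_mul, Complex.ofReal_cos, Complex.ofReal_sin, Complex.cos_sub_sin_I]
    congr 1; push_cast; ring
  have e3 : Complex.exp (-(Complex.I * α / 2)) * Complex.exp (Complex.I * α / 2) = 1 := by
    rw [← Complex.exp_add]; simp
  simp only [vecForm_apply, spinorZ, mul_pow, e1, e2]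
  rw [mul_mul_mul_comm (Complex.exp _) w.1, e3, one_mul]
  simp [rotZ, Matrix.mulVec, dotProduct, Fin.sum_univ_three]
  linear_combination (w.2 ^ 2 * (-a 1 * Complex.sin α) / (√2 : ℝ)
    + w.1 ^ 2 * (a 1 * Complex.sin α) / (√2 : ℝ)) * Complex.I_sq

theorem vecForm_rotY (β : ℝ) (a : Fin 3 → ℝ) (w : ℂ × ℂ) :
    vecForm ((rotY β).mulVec a) w = vecForm a (spinorY β w) := by
  have e1 : Real.cos β = 2 * Real.cos (β / 2) ^ 2 - 1 := by
    rw [← Real.cos_two_mul]; congr 1; ring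
  have e2 : Real.sin β = 2 * Real.sin (β / 2) * Real.cos (β / 2) := by
    rw [← Real.sin_two_mul]; congr 1; ring
  have e3 : (Real.sin (β / 2) : ℂ) ^ 2 + (Real.cos (β / 2) : ℂ) ^ 2 = 1 := by
    exact_mod_cast Real.sin_sq_add_cos_sq (β / 2)
  have h2 : (√2 : ℂ) ≠ 0 := by norm_num
  have h3 : (√2 : ℂ) ^ 2 = 2 := by
    rw [← Complex.ofReal_pow, Real.sq_sqrt (by norm_num)]; norm_num
  simp only [vecForm_apply, spinorY]
  simp [rotY, Matrix.mulVec, dotProduct, Fin.sum_univ_three, -Complex.ofReal_cos,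
    -Complex.ofReal_sin, e1, e2]
  generalize (Real.cos (β / 2) : ℂ) = c at *
  generalize (Real.sin (β / 2) : ℂ) = s at *
  field_simp
  simp only [h3]
  linear_combination (a 0 * w.2 ^ 2 + 2 * a 2 * w.1 * w.2 - a 0 * w.1 ^ 2
    - a 1 * Complex.I * (w.1 ^ 2 + w.2 ^ 2)) * e3

/-- Substitutions compose in the opposite order, which is why `spinorRotation` applies the angle `α`
first. -/
theorem vecForm_eulerRotation (α β γ : ℝ) (a : Fin 3 → ℝ) (w : ℂ × ℂ) :
    vecForm ((eulerRotation α β γ).mulVec a) w = vecForm a (spinorRotation α β γ w) := by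
  rw [eulerRotation, ← Matrix.mulVec_mulVec, ← Matrix.mulVec_mulVec, vecForm_rotZ, vecForm_rotY,
    vecForm_rotZ, spinorRotation]

/-! ### Euler angles for the orthogonal group -/

theorem rotZ_mem (θ : ℝ) : rotZ θ ∈ Matrix.orthogonalGroup (Fin 3) ℝ := by
  rw [Matrix.mem_orthogonalGroup_iff]
  ext i j
  have := Real.sin_sq_add_cos_sq θ
  fin_cases i <;> fin_cases j <;> simp [rotZ, Matrix.mul_apply, Fin.sum_univ_three] <;> linarith

theorem rotY_mem (θ : ℝ) : rotY θ ∈ Matrix.orthogonalGroup (Fin 3) ℝ := by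
  rw [Matrix.mem_orthogonalGroup_iff]
  ext i j
  have := Real.sin_sq_add_cos_sq θ
  fin_cases i <;> fin_cases j <;> simp [rotY, Matrix.mul_apply, Fin.sum_univ_three] <;> linarith

theorem det_rotZ (θ : ℝ) : (rotZ θ).det = 1 := by
  have := Real.sin_sq_add_cos_sq θ
  simp [rotZ, Matrix.det_fin_three]; linarith

theorem det_rotY (θ : ℝ) : (rotY θ).det = 1 := by
  have := Real.sin_sq_add_cos_sq θ
  simp [rotY, Matrix.det_fin_three]; linarith

theorem exists_polar (a b : ℝ) : ∃ α : ℝ, a = √(a ^ 2 + b ^ 2) * Real.cos α ∧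
    b = √(a ^ 2 + b ^ 2) * Real.sin α := by
  refine ⟨Complex.arg ⟨a, b⟩, ?_, ?_⟩
  · have := Complex.norm_mul_cos_arg ⟨a, b⟩
    rw [Complex.norm_def, Complex.normSq_mk, ← sq, ← sq] at this
    exact this.symm
  · have := Complex.norm_mul_sin_arg ⟨a, b⟩
    rw [Complex.norm_def, Complex.normSq_mk, ← sq, ← sq] at this
    exact this.symm

/-- Every unit vector is the image of the third basis vector under some rotation. -/
theorem exists_rotation_col (a b c : ℝ) (h : a ^ 2 + b ^ 2 + c ^ 2 = 1) :
    ∃ α β : ℝ, a = Real.sin β * Real.cos α ∧ b = Real.sin β * Real.sin α ∧ c = Real.cos β := by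
  obtain ⟨α, h1, h2⟩ := exists_polar a b
  obtain ⟨β, h3, h4⟩ := exists_polar c (√(a ^ 2 + b ^ 2))
  rw [Real.sq_sqrt (by positivity), show c ^ 2 + (a ^ 2 + b ^ 2) = 1 by linarith, Real.sqrt_one,
    one_mul] at h3 h4
  refine ⟨α, β, ?_, ?_, h3⟩
  · rw [← h4]; exact h1
  · rw [← h4]; exact h2

theorem eq_rotZ_of_fixes {N : Matrix (Fin 3) (Fin 3) ℝ}
    (hN : N ∈ Matrix.orthogonalGroup (Fin 3) ℝ) (hdet : N.det = 1)
    (h0 : N 0 2 = 0) (h1 : N 1 2 = 0) (h2 : N 2 2 = 1) : ∃ γ, N = rotZ γ := by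
  have A := Unitary.mul_star_self_of_mem hN
  have B := Unitary.star_mul_self_of_mem hN
  have a22 := congrFun (congrFun A 2) 2
  have b00 := congrFun (congrFun B 0) 0
  have b11 := congrFun (congrFun B 1) 1
  simp [Matrix.mul_apply, Fin.sum_univ_three, h2] at a22 b00 b11
  have e20 : N 2 0 = 0 := by nlinarith [mul_self_nonneg (N 2 0), mul_self_nonneg (N 2 1)]
  have e21 : N 2 1 = 0 := by nlinarith [mul_self_nonneg (N 2 0), mul_self_nonneg (N 2 1)]
  rw [Matrix.det_fin_three, h0, h1, h2, e20, e21] at hdet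
  rw [e20] at b00
  rw [e21] at b11
  -- The left side is the sum of the squares of the four entries minus twice the determinant of the
  -- block, that is `2 - 2`.
  have k : (N 0 0 - N 1 1) ^ 2 + (N 0 1 + N 1 0) ^ 2 = 0 := by nlinarith
  have k1 : N 1 1 = N 0 0 := by nlinarith [sq_nonneg (N 0 0 - N 1 1), sq_nonneg (N 0 1 + N 1 0)]
  have k2 : N 0 1 = -N 1 0 := by nlinarith [sq_nonneg (N 0 0 - N 1 1), sq_nonneg (N 0 1 + N 1 0)]
  obtain ⟨γ, g1, g2⟩ := exists_polar (N 0 0) (N 1 0)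
  rw [show N 0 0 ^ 2 + N 1 0 ^ 2 = 1 by linarith, Real.sqrt_one, one_mul] at g1 g2
  refine ⟨γ, ?_⟩
  ext i j
  fin_cases i <;> fin_cases j <;>
    simp [rotZ, ← g1, ← g2, h0, h1, h2, e20, e21, k1, k2]

/-- Two angles suffice to match the third column of `Q`; the remaining factor fixes the third axis
and is a rotation about it. -/
theorem exists_eulerRotation {Q : Matrix (Fin 3) (Fin 3) ℝ}
    (hQ : Q ∈ Matrix.orthogonalGroup (Fin 3) ℝ) (hdet : Q.det = 1) :
    ∃ α β γ, Q = eulerRotation α β γ := by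
  have B := Unitary.star_mul_self_of_mem hQ
  have b22 := congrFun (congrFun B 2) 2
  simp [Matrix.mul_apply, Fin.sum_univ_three] at b22
  obtain ⟨α, β, h0, h1, h2⟩ := exists_rotation_col (Q 0 2) (Q 1 2) (Q 2 2) (by linarith)
  have hR : rotZ α * rotY β ∈ Matrix.orthogonalGroup (Fin 3) ℝ := mul_mem (rotZ_mem α) (rotY_mem β)
  set R := rotZ α * rotY β with hRdef
  have hRdet : R.det = 1 := by rw [hRdef, Matrix.det_mul, det_rotZ, det_rotY, one_mul]
  have hcol : ∀ i, R i 2 = Q i 2 := by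
    intro i
    fin_cases i <;> simp [hRdef, rotZ, rotY, h0, h1, h2]
      <;> ring
  have hRR := Unitary.star_mul_self_of_mem hR
  have hN : ∀ i, (star R * Q) i 2 = (1 : Matrix (Fin 3) (Fin 3) ℝ) i 2 := by
    intro i
    rw [← hRR, Matrix.mul_apply, Matrix.mul_apply]
    exact Finset.sum_congr rfl fun j _ => by rw [hcol]
  obtain ⟨γ, hγ⟩ := eq_rotZ_of_fixes (N := star R * Q)
    (mul_mem (Unitary.star_mem hR) hQ)
    (by rw [Matrix.det_mul, hdet, Matrix.star_eq_conjTranspose, Matrix.det_conjTranspose, hRdet]; simp)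
    (by rw [hN]; simp) (by rw [hN]; simp) (by rw [hN]; simp)
  refine ⟨α, β, γ, ?_⟩
  rw [eulerRotation, ← hRdef, ← hγ, ← mul_assoc, Unitary.mul_star_self_of_mem hR, one_mul]

/-- In odd dimension negation reverses the sign of the determinant, so O(3) is generated by SO(3)
and the inversion. -/
theorem exists_eulerRotation_or_neg {Q : Matrix (Fin 3) (Fin 3) ℝ}
    (hQ : Q ∈ Matrix.orthogonalGroup (Fin 3) ℝ) :
    ∃ α β γ, Q = eulerRotation α β γ ∨ Q = -eulerRotation α β γ := by
  have hd : Q.det * Q.det = 1 := by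
    have := congrArg Matrix.det (Unitary.mul_star_self_of_mem hQ)
    rw [Matrix.det_mul, Matrix.star_eq_conjTranspose, Matrix.det_conjTranspose] at this
    simpa using this
  rcases mul_self_eq_one_iff.mp hd with h | h
  · obtain ⟨α, β, γ, e⟩ := exists_eulerRotation hQ h
    exact ⟨α, β, γ, Or.inl e⟩
  · have hQ' : -Q ∈ Matrix.orthogonalGroup (Fin 3) ℝ := by
      rw [Matrix.mem_orthogonalGroup_iff] at *
      simpa using hQ
    obtain ⟨α, β, γ, e⟩ := exists_eulerRotation hQ' (by
      rw [Matrix.det_neg, h]; norm_num)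
    exact ⟨α, β, γ, Or.inr (by rw [← e, neg_neg])⟩

/-- A nonzero vector can be rotated onto the third axis. -/
theorem exists_orthogonal_mulVec_axis {d : Fin 3 → ℝ} (hd : d ≠ 0) :
    ∃ Q ∈ Matrix.orthogonalGroup (Fin 3) ℝ, ∃ t : ℝ, t ≠ 0 ∧ Q.mulVec d = ![0, 0, t] := by
  have hpos : 0 < d 0 ^ 2 + d 1 ^ 2 + d 2 ^ 2 := by
    by_contra! hle
    apply hd
    ext i
    fin_cases i <;> simp <;> nlinarith [sq_nonneg (d 0), sq_nonneg (d 1), sq_nonneg (d 2)]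
  set ρ := √(d 0 ^ 2 + d 1 ^ 2 + d 2 ^ 2) with hρ
  have hρ0 : ρ ≠ 0 := (Real.sqrt_pos.mpr hpos).ne'
  have hρ2 : ρ ^ 2 = d 0 ^ 2 + d 1 ^ 2 + d 2 ^ 2 := Real.sq_sqrt hpos.le
  obtain ⟨α, β, h0, h1, h2⟩ := exists_rotation_col (d 0 / ρ) (d 1 / ρ) (d 2 / ρ) (by
    rw [div_pow, div_pow, div_pow, ← add_div, ← add_div, ← hρ2, div_self (pow_ne_zero 2 hρ0)])
  have hR : rotZ α * rotY β ∈ Matrix.orthogonalGroup (Fin 3) ℝ := mul_mem (rotZ_mem α) (rotY_mem β)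
  refine ⟨star (rotZ α * rotY β), Unitary.star_mem hR, ρ, hρ0, ?_⟩
  have hdR : d = (rotZ α * rotY β).mulVec ![0, 0, ρ] := by
    rw [div_eq_iff hρ0] at h0 h1 h2
    ext i
    fin_cases i <;> simp [rotZ, rotY, Matrix.mulVec, dotProduct, Matrix.mul_apply,
      Fin.sum_univ_three, h0, h1, h2, mul_comm]
  rw [hdR, Matrix.mulVec_mulVec, Unitary.star_mul_self_of_mem hR, Matrix.one_mulVec]

/-! ### Proper harmonic tensors as forms -/

/-- The components of an element of `ℝ^(2L+1)`, extended by zero. -/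
noncomputable def tensorComp {L : ℕ} (t : MIdx L → ℝ) : ℤ → ℂ := fun μ =>
  if h : μ ∈ Finset.Icc (-(L : ℤ)) L then (t ⟨μ, h⟩ : ℂ) else 0

/-- The form of an element of `ℝ^(2L+1)`. -/
noncomputable def tensorForm {L : ℕ} (t : MIdx L → ℝ) : ℂ × ℂ → ℂ := spinorForm L (tensorComp t)

theorem tensorComp_apply {L : ℕ} (t : MIdx L → ℝ) (μ : MIdx L) : tensorComp t μ = t μ := by
  rw [tensorComp, dif_pos μ.2]

section ProperHarmonicTensor

variable {n L : ℕ} {T : (Fin n → Fin 3 → ℝ) → MIdx L → ℝ}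

theorem tensorForm_eulerRotation (hT : IsProperHarmonicTensor T) (α β γ : ℝ)
    (r : Fin n → Fin 3 → ℝ) (w : ℂ × ℂ) :
    tensorForm (T fun i => (eulerRotation α β γ).mulVec (r i)) w
      = tensorForm (T r) (spinorRotation α β γ w) := by
  rw [tensorForm, tensorForm, ← spinorForm_realWignerD]
  refine congrFun (spinorForm_congr fun μ hμ => ?_) w
  rw [show μ = ((⟨μ, hμ⟩ : MIdx L) : ℤ) from rfl, tensorComp_apply, hT.rotation,
    ← Finset.sum_coe_sort (Finset.Icc (-(L : ℤ)) L)]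
  exact Finset.sum_congr rfl fun μ' _ => by rw [tensorComp_apply]

theorem tensorForm_neg (hT : IsProperHarmonicTensor T) (r : Fin n → Fin 3 → ℝ) (w : ℂ × ℂ) :
    tensorForm (T fun i => -r i) w = (-1) ^ L * tensorForm (T r) w := by
  have : tensorForm (T fun i => -r i) = ((-1 : ℂ) ^ L) • tensorForm (T r) := by
    rw [tensorForm, tensorForm, ← spinorForm_smul]
    refine spinorForm_congr fun μ hμ => ?_
    rw [Pi.smul_apply, show μ = ((⟨μ, hμ⟩ : MIdx L) : ℤ) from rfl, tensorComp_apply,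
      tensorComp_apply, hT.inversion]
    simp
  rw [this]; rfl

/-- Orthogonal transformations of the inputs act by substitutions, up to a sign. -/
theorem exists_substitution {Q : Matrix (Fin 3) (Fin 3) ℝ}
    (hQ : Q ∈ Matrix.orthogonalGroup (Fin 3) ℝ) (hT : IsProperHarmonicTensor T) :
    ∃ (ε : ℂ) (g : ℂ × ℂ → ℂ × ℂ), ε * ε = 1 ∧
      (∀ a w, vecForm (Q.mulVec a) w = ε * vecForm a (g w)) ∧
      ∀ r w, tensorForm (T fun i => Q.mulVec (r i)) w = ε ^ L * tensorForm (T r) (g w) := by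
  obtain ⟨α, β, γ, rfl | rfl⟩ := exists_eulerRotation_or_neg hQ
  · refine ⟨1, spinorRotation α β γ, by simp, fun a w => ?_, fun r w => ?_⟩
    · rw [vecForm_eulerRotation, one_mul]
    · rw [tensorForm_eulerRotation hT, one_pow, one_mul]
  · refine ⟨-1, spinorRotation α β γ, by simp, fun a w => ?_, fun r w => ?_⟩
    · rw [Matrix.neg_mulVec, map_neg, Pi.neg_apply, vecForm_eulerRotation, neg_one_mul]
    · simp only [Matrix.neg_mulVec]
      rw [tensorForm_neg hT, tensorForm_eulerRotation hT]

/-- The complex span of the forms of the input vectors. -/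
noncomputable def inputSpan (r : Fin n → Fin 3 → ℝ) : Submodule ℂ (ℂ × ℂ → ℂ) :=
  Submodule.span ℂ (Set.range fun i => vecForm (r i))

theorem vecForm_mem_inputSpan {r : Fin n → Fin 3 → ℝ} {a : Fin 3 → ℝ}
    (ha : a ∈ Submodule.span ℝ (Set.range r)) : vecForm a ∈ inputSpan r := by
  have h : Submodule.span ℝ (Set.range r)
      ≤ ((inputSpan r).restrictScalars ℝ).comap vecForm := by
    rw [Submodule.span_le]
    rintro _ ⟨i, rfl⟩
    exact Submodule.subset_span ⟨i, rfl⟩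
  exact h ha

/-- Substitution as a homomorphism of algebras of functions. -/
def substHom (g : ℂ × ℂ → ℂ × ℂ) : (ℂ × ℂ → ℂ) →ₐ[ℂ] (ℂ × ℂ → ℂ) where
  toFun f := f ∘ g
  map_one' := rfl
  map_mul' _ _ := rfl
  map_zero' := rfl
  map_add' _ _ := rfl
  commutes' _ := rfl

/-- This permits moving the inputs to a convenient position. The substitution belonging to `star Q`
is an algebra homomorphism, so it carries the power of one span into the power of the other, and the
signs are absorbed as scalars. -/
theorem tensorForm_mem_of_mulVec (hT : IsProperHarmonicTensor T) {Q : Matrix (Fin 3) (Fin 3) ℝ}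
    (hQ : Q ∈ Matrix.orthogonalGroup (Fin 3) ℝ) {r : Fin n → Fin 3 → ℝ}
    (h : tensorForm (T fun i => Q.mulVec (r i)) ∈ inputSpan (fun i => Q.mulVec (r i)) ^ L) :
    tensorForm (T r) ∈ inputSpan r ^ L := by
  obtain ⟨ε, g, hε, hv, hF⟩ := exists_substitution (Unitary.star_mem hQ) hT
  have hback : ∀ a, (star Q).mulVec (Q.mulVec a) = a := fun a => by
    rw [Matrix.mulVec_mulVec, Unitary.star_mul_self_of_mem hQ, Matrix.one_mulVec]
  have hle : (inputSpan fun i => Q.mulVec (r i)).map (substHom g).toLinearMap ≤ inputSpan r := by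
    rw [inputSpan, Submodule.map_span, Submodule.span_le]
    rintro _ ⟨_, ⟨i, rfl⟩, rfl⟩
    have : (substHom g).toLinearMap (vecForm (Q.mulVec (r i))) = ε • vecForm (r i) := by
      ext w
      have := hv (Q.mulVec (r i)) w
      rw [hback] at this
      rw [Pi.smul_apply, smul_eq_mul, this, ← mul_assoc, hε, one_mul]
      rfl
    simp only [SetLike.mem_coe]
    rw [this]
    exact Submodule.smul_mem _ _ (Submodule.subset_span ⟨i, rfl⟩)
  have hmem := Submodule.mem_map_of_mem (f := (substHom g).toLinearMap) h
  rw [Submodule.map_pow] at hmem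
  have hmem2 := Submodule.smul_mem _ (ε ^ L) (pow_le_pow_left' hle L hmem)
  convert hmem2 using 1
  ext w
  have := hF (fun i => Q.mulVec (r i)) w
  simp only [hback] at this
  rw [this]; rfl

/-! ### Membership of basis forms in powers of a space of quadratic forms -/

theorem spinorBasis_eq_smul (l : ℕ) (m : ℤ) :
    spinorBasis l m = ((√(zfact (2 * l)) / (√(zfact (l + m)) * √(zfact (l - m))) : ℝ) : ℂ) •
      ((Prod.fst : ℂ × ℂ → ℂ) ^ (l + m).toNat * (Prod.snd : ℂ × ℂ → ℂ) ^ (l - m).toNat) := by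
  ext w; simp [spinorBasis, mul_assoc]

theorem pow_mul_pow_mem {V : Submodule ℂ (ℂ × ℂ → ℂ)} (hu : (Prod.fst : ℂ × ℂ → ℂ) ^ 2 ∈ V)
    (hv : (Prod.snd : ℂ × ℂ → ℂ) ^ 2 ∈ V) (a b : ℕ) :
    (Prod.fst : ℂ × ℂ → ℂ) ^ (2 * a) * (Prod.snd : ℂ × ℂ → ℂ) ^ (2 * b) ∈ V ^ (a + b) := by
  rw [pow_mul, pow_mul, pow_add]
  exact Submodule.mul_mem_mul (Submodule.pow_mem_pow _ hu _) (Submodule.pow_mem_pow _ hv _)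

theorem spinorBasis_mem_of_even {V : Submodule ℂ (ℂ × ℂ → ℂ)}
    (hu : (Prod.fst : ℂ × ℂ → ℂ) ^ 2 ∈ V) (hv : (Prod.snd : ℂ × ℂ → ℂ) ^ 2 ∈ V) {l : ℕ} {m : ℤ}
    (hm : m ∈ Finset.Icc (-(l : ℤ)) l) (he : Even (l + m)) : spinorBasis l m ∈ V ^ l := by
  rw [Finset.mem_Icc] at hm
  obtain ⟨c, hc⟩ := he
  rw [spinorBasis_eq_smul, show (l + m).toNat = 2 * c.toNat by omega,
    show (l - m).toNat = 2 * (l - c.toNat) by omega]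
  have := pow_mul_pow_mem hu hv c.toNat (l - c.toNat)
  rw [show c.toNat + (l - c.toNat) = l by omega] at this
  exact Submodule.smul_mem _ _ this

theorem spinorBasis_mem {V : Submodule ℂ (ℂ × ℂ → ℂ)}
    (hu : (Prod.fst : ℂ × ℂ → ℂ) ^ 2 ∈ V) (hv : (Prod.snd : ℂ × ℂ → ℂ) ^ 2 ∈ V)
    (huv : (Prod.fst : ℂ × ℂ → ℂ) * Prod.snd ∈ V) {l : ℕ} {m : ℤ}
    (hm : m ∈ Finset.Icc (-(l : ℤ)) l) : spinorBasis l m ∈ V ^ l := by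
  rcases Int.even_or_odd (l + m) with he | ⟨c, hc⟩
  · exact spinorBasis_mem_of_even hu hv hm he
  rw [Finset.mem_Icc] at hm
  -- Both exponents are odd, so one factor uv is split off and the rest is a product of squares.
  rw [spinorBasis_eq_smul, show (l + m).toNat = 2 * c.toNat + 1 by omega,
    show (l - m).toNat = 2 * (l - 1 - c.toNat) + 1 by omega]
  have := Submodule.mul_mem_mul (pow_mul_pow_mem hu hv c.toNat (l - 1 - c.toNat)) huv
  rw [← pow_succ, show c.toNat + (l - 1 - c.toNat) + 1 = l by omega] at this
  refine Submodule.smul_mem _ _ ?_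
  convert this using 1
  ring

theorem spinorBasis_zero_mem {V : Submodule ℂ (ℂ × ℂ → ℂ)}
    (huv : (Prod.fst : ℂ × ℂ → ℂ) * Prod.snd ∈ V) (l : ℕ) : spinorBasis l 0 ∈ V ^ l := by
  rw [spinorBasis_eq_smul, show ((l : ℤ) + 0).toNat = l by omega,
    show ((l : ℤ) - 0).toNat = l by omega, ← mul_pow]
  exact Submodule.smul_mem _ _ (Submodule.pow_mem_pow _ huv _)

theorem sqrt_two_complex_ne_zero : ((√2 : ℝ) : ℂ) ≠ 0 := by norm_num

/-- The x- and y-axes have the forms `(v² - u²)/√2` and `i(u² + v²)/√2`, which can be solved for u²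
and v². -/
theorem squares_mem {V : Submodule ℂ (ℂ × ℂ → ℂ)} (hx : vecForm ![1, 0, 0] ∈ V)
    (hy : vecForm ![0, 1, 0] ∈ V) :
    (Prod.fst : ℂ × ℂ → ℂ) ^ 2 ∈ V ∧ (Prod.snd : ℂ × ℂ → ℂ) ^ 2 ∈ V := by
  have h3 : (√2 : ℂ) ^ 2 = 2 := by
    rw [← Complex.ofReal_pow, Real.sq_sqrt (by norm_num)]; norm_num
  have h2 := sqrt_two_complex_ne_zero
  have e1 : (Prod.fst : ℂ × ℂ → ℂ) ^ 2 = (-Complex.I / (√2 : ℝ)) • vecForm ![0, 1, 0]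
      + (-1 / (√2 : ℝ) : ℂ) • vecForm ![1, 0, 0] := by
    ext w
    simp [vecForm_apply]
    field_simp
    linear_combination (w.1 ^ 2) * h3 + (w.1 ^ 2 + w.2 ^ 2) * Complex.I_sq
  have e2 : (Prod.snd : ℂ × ℂ → ℂ) ^ 2 = (-Complex.I / (√2 : ℝ)) • vecForm ![0, 1, 0]
      + (1 / (√2 : ℝ) : ℂ) • vecForm ![1, 0, 0] := by
    ext w
    simp [vecForm_apply]
    field_simp
    linear_combination (w.2 ^ 2) * h3 + (w.1 ^ 2 + w.2 ^ 2) * Complex.I_sq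
  rw [e1, e2]
  exact ⟨add_mem (Submodule.smul_mem _ _ hy) (Submodule.smul_mem _ _ hx),
    add_mem (Submodule.smul_mem _ _ hy) (Submodule.smul_mem _ _ hx)⟩

theorem fst_mul_snd_mem {V : Submodule ℂ (ℂ × ℂ → ℂ)} {a : Fin 3 → ℝ} (h0 : a 0 = 0)
    (h1 : a 1 = 0) (h2 : a 2 ≠ 0) (ha : vecForm a ∈ V) :
    (Prod.fst : ℂ × ℂ → ℂ) * Prod.snd ∈ V := by
  have hs := sqrt_two_complex_ne_zero
  have h2c : (a 2 : ℂ) ≠ 0 := by exact_mod_cast h2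
  have e : (Prod.fst : ℂ × ℂ → ℂ) * Prod.snd = ((√2 : ℝ) * a 2 : ℂ)⁻¹ • vecForm a := by
    ext w
    simp [vecForm_apply, h0, h1]
    field_simp
  rw [e]
  exact Submodule.smul_mem _ _ ha

/-! ### The form of a proper harmonic tensor is generated by the forms of the inputs -/

theorem tensorForm_mem_of_forall_basis {V : Submodule ℂ (ℂ × ℂ → ℂ)} (t : MIdx L → ℝ)
    (h : ∀ m ∈ Finset.Icc (-(L : ℤ)) L, complexComp L (tensorComp t) m = 0
      ∨ spinorBasis L m ∈ V) : tensorForm t ∈ V := by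
  have e : tensorForm t = ∑ m ∈ Finset.Icc (-(L : ℤ)) L,
      complexComp L (tensorComp t) m • spinorBasis L m := by
    ext w; rw [tensorForm, spinorForm_eq]; simp
  rw [e]
  refine Submodule.sum_mem _ fun m hm => ?_
  rcases h m hm with h | h
  · rw [h, zero_smul]; exact Submodule.zero_mem _
  · exact Submodule.smul_mem _ _ h

/-- The basis form of index `m` is an eigenvector of the substitution, so invariance up to `σ` kills
every weight whose total eigenvalue is not 1. -/
theorem complexComp_eq_zero_of_rotZ {t : MIdx L → ℝ} {α : ℝ} {σ : ℂ}
    (h : ∀ w, tensorForm t w = σ * tensorForm t (spinorZ α w)) {m : ℤ}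
    (hm : m ∈ Finset.Icc (-(L : ℤ)) L) (hne : σ * Complex.exp (-(Complex.I * m * α)) ≠ 1) :
    complexComp L (tensorComp t) m = 0 := by
  have key := eq_zero_of_sum_spinorBasis (l := L) (X := fun m =>
    (1 - σ * Complex.exp (-(Complex.I * m * α))) * complexComp L (tensorComp t) m) (fun w => by
      have h1 := h w
      rw [tensorForm, spinorForm_eq, spinorForm_eq, Finset.mul_sum, ← sub_eq_zero,
        ← Finset.sum_sub_distrib] at h1
      rw [← h1]
      refine Finset.sum_congr rfl fun m hm => ?_
      rw [spinorBasis_spinorZ hm]; ring) m hm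
  exact (mul_eq_zero.mp key).resolve_left (sub_ne_zero.mpr hne.symm)

theorem eulerRotation_zero_zero (α : ℝ) : eulerRotation α 0 0 = rotZ α := by
  have h1 : rotY 0 = 1 := by
    ext i j; fin_cases i <;> fin_cases j <;> simp [rotY]
  have h2 : rotZ 0 = 1 := by
    ext i j; fin_cases i <;> fin_cases j <;> simp [rotZ]
  rw [eulerRotation, h1, h2, mul_one, mul_one]

theorem tensorForm_rotZ (hT : IsProperHarmonicTensor T) (α : ℝ) (r : Fin n → Fin 3 → ℝ)
    (w : ℂ × ℂ) :
    tensorForm (T fun i => (rotZ α).mulVec (r i)) w = tensorForm (T r) (spinorZ α w) := by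
  rw [← eulerRotation_zero_zero, tensorForm_eulerRotation hT]
  simp [spinorRotation, spinorY, spinorZ]

/-- Rotations about the z-axis fix the inputs, so only the weight `m = 0`, a multiple of (uv)^L,
survives; uv is available as soon as one input is nonzero. Zero inputs need a further rotation. -/
theorem tensorForm_mem_of_axis (hT : IsProperHarmonicTensor T) {r : Fin n → Fin 3 → ℝ}
    (h0 : ∀ i, r i 0 = 0) (h1 : ∀ i, r i 1 = 0) : tensorForm (T r) ∈ inputSpan r ^ L := by
  have hfix : ∀ α, (fun i => (rotZ α).mulVec (r i)) = r := by
    intro α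
    ext i j
    fin_cases j <;> simp [rotZ, Matrix.mulVec, dotProduct, Fin.sum_univ_three, h0, h1]
  have hX : ∀ m ∈ Finset.Icc (-(L : ℤ)) L, m ≠ 0 → complexComp L (tensorComp (T r)) m = 0 := by
    intro m hm hm0
    -- The angle `π / m` turns the eigenvalue at weight `m` into -1.
    refine complexComp_eq_zero_of_rotZ (α := Real.pi / m) (σ := 1) (fun w => ?_) hm ?_
    · rw [← tensorForm_rotZ hT, hfix, one_mul]
    · have hmc : (m : ℂ) ≠ 0 := by exact_mod_cast hm0
      have : -(Complex.I * m * ((Real.pi / m : ℝ) : ℂ)) = -(Real.pi * Complex.I) := by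
        push_cast; field_simp
      rw [this, Complex.exp_neg, Complex.exp_pi_mul_I]
      norm_num
  by_cases hr : ∃ i, r i 2 ≠ 0
  · obtain ⟨i, hi⟩ := hr
    have huv := fst_mul_snd_mem (V := inputSpan r) (h0 i) (h1 i) hi (Submodule.subset_span ⟨i, rfl⟩)
    refine tensorForm_mem_of_forall_basis _ fun m hm => ?_
    by_cases hm0 : m = 0
    · subst hm0; exact Or.inr (spinorBasis_zero_mem huv L)
    · exact Or.inl (hX m hm hm0)
  push Not at hr
  have hF : ∀ w, tensorForm (T r) w = complexComp L (tensorComp (T r)) 0 * spinorBasis L 0 w := by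
    intro w
    rw [tensorForm, spinorForm_eq, Finset.sum_eq_single 0]
    · intro m hm hm0; rw [hX m hm hm0, zero_mul]
    · intro h; exact absurd (by simp) h
  rcases Nat.eq_zero_or_pos L with rfl | hL
  · refine tensorForm_mem_of_forall_basis _ fun m hm => Or.inr ?_
    have : m = 0 := by simpa using hm
    subst this
    rw [spinorBasis_eq_smul]
    have h1 : (1 : ℂ × ℂ → ℂ) ∈ inputSpan r ^ 0 := by
      rw [pow_zero]; exact Submodule.one_le.mp le_rfl
    simpa using Submodule.smul_mem _ _ h1
  · have hzero : r = fun i => (eulerRotation 0 (Real.pi / 2) 0).mulVec (r i) := by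
      have : r = fun _ => 0 := by
        ext i j
        fin_cases j <;> simp [h0, h1, hr]
      rw [this]; simp
    -- The point (1, 0), where uv vanishes, is sent to (cos π/4, -sin π/4), where it does not; for
    -- `L > 0` this forces the remaining coefficient to be zero.
    have hw := tensorForm_eulerRotation hT 0 (Real.pi / 2) 0 r (1, 0)
    rw [← hzero, hF, hF, spinorBasis_eq_smul] at hw
    have hz : zfact L ≠ 0 := (zfact_pos _).ne'
    have hs := (Real.sqrt_pos.mpr (zfact_pos (2 * L))).ne'
    have hs' := (Real.sqrt_pos.mpr (zfact_pos L)).ne'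
    have e4 : Real.pi / 2 / 2 = Real.pi / 4 := by ring
    have hX0 : complexComp L (tensorComp (T r)) 0 = 0 := by
      simpa [spinorRotation, spinorY, spinorZ, hL.ne', hs, hs', e4, -Complex.ofReal_cos,
        -Complex.ofReal_sin, Real.cos_pi_div_four, Real.sin_pi_div_four] using hw
    refine tensorForm_mem_of_forall_basis _ fun m hm => Or.inl ?_
    by_cases hm0 : m = 0
    · subst hm0; exact hX0
    · exact hX m hm hm0

theorem exists_dotProduct_eq_zero {W : Submodule ℝ (Fin 3 → ℝ)} (hW : W ≠ ⊤) :
    ∃ d : Fin 3 → ℝ, d ≠ 0 ∧ ∀ a ∈ W, d ⬝ᵥ a = 0 := by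
  obtain ⟨f, hf, hle⟩ := Submodule.exists_le_ker_of_lt_top W (lt_top_iff_ne_top.mpr hW)
  have hfd : ∀ a, f a = (fun i => f (Pi.single i 1)) ⬝ᵥ a := by
    intro a
    conv_lhs => rw [← LinearMap.sum_single_apply (fun _ => ℝ) a]
    rw [map_sum, dotProduct]
    refine Finset.sum_congr rfl fun i _ => ?_
    rw [mul_comm, ← smul_eq_mul, ← map_smul]
    congr 1
    ext j; simp [Pi.single_apply]
  refine ⟨fun i => f (Pi.single i 1), fun h => hf ?_, fun a ha => ?_⟩
  · refine LinearMap.ext fun a => ?_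
    rw [hfd, h]; simp
  · rw [← hfd]; exact hle ha

/-- If the inputs span the whole plane, the reflection in it restricts the weights; otherwise they
lie on a line and the axis case applies after a rotation. -/
theorem tensorForm_mem_of_plane (hT : IsProperHarmonicTensor T) {r : Fin n → Fin 3 → ℝ}
    (h2 : ∀ i, r i 2 = 0) : tensorForm (T r) ∈ inputSpan r ^ L := by
  -- Adjoining the third axis tests whether the inputs fill the plane. If they do not, a normal
  -- vector to this larger span lies in the plane itself.
  by_cases hW : Submodule.span ℝ (Set.range r) ⊔ Submodule.span ℝ {![0, 0, 1]} = ⊤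
  · have hz : ∀ a ∈ Submodule.span ℝ (Set.range r), a 2 = 0 := by
      have : Submodule.span ℝ (Set.range r) ≤ LinearMap.ker
          (LinearMap.proj 2 : (Fin 3 → ℝ) →ₗ[ℝ] ℝ) := by
        rw [Submodule.span_le]
        rintro _ ⟨i, rfl⟩
        exact h2 i
      exact fun a ha => this ha
    have hmem : ∀ a : Fin 3 → ℝ, a 2 = 0 → a ∈ Submodule.span ℝ (Set.range r) := by
      intro a ha
      have : a ∈ Submodule.span ℝ (Set.range r) ⊔ Submodule.span ℝ {![0, 0, 1]} := by
        rw [hW]; trivial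
      obtain ⟨b, hb, c, hc, rfl⟩ := Submodule.mem_sup.mp this
      obtain ⟨t, rfl⟩ := Submodule.mem_span_singleton.mp hc
      have ht : t = 0 := by simpa [hz b hb] using ha
      simpa [ht] using hb
    obtain ⟨hu, hv⟩ := squares_mem (V := inputSpan r)
      (vecForm_mem_inputSpan (hmem _ (by simp))) (vecForm_mem_inputSpan (hmem _ (by simp)))
    refine tensorForm_mem_of_forall_basis _ fun m hm => ?_
    rcases Int.even_or_odd (L + m) with he | ho
    · exact Or.inr (spinorBasis_mem_of_even hu hv hm he)
    -- The reflection is the inversion composed with the rotation by π. Its eigenvalue at weight `m`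
    -- is `(-1)^(L+m)`, which is -1 here.
    refine Or.inl (complexComp_eq_zero_of_rotZ (α := Real.pi) (σ := (-1) ^ L) (fun w => ?_) hm ?_)
    · rw [← tensorForm_rotZ hT, ← tensorForm_neg hT]
      congr 2
      ext i j
      fin_cases j <;> simp [rotZ, dotProduct, Fin.sum_univ_three, h2]
    · have e : -(Complex.I * m * (Real.pi : ℂ)) = m * (-(Real.pi * Complex.I)) := by ring
      rw [e, Complex.exp_int_mul, Complex.exp_neg, Complex.exp_pi_mul_I, ← zpow_natCast,
        show ((-1 : ℂ)⁻¹) = -1 by norm_num, ← zpow_add₀ (by norm_num), ho.neg_one_zpow]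
      norm_num
  · obtain ⟨d, hd, hdW⟩ := exists_dotProduct_eq_zero hW
    have hd2 : d 2 = 0 := by
      simpa [dotProduct, Fin.sum_univ_three] using
        hdW _ (Submodule.mem_sup_right (Submodule.mem_span_singleton_self _))
    have hdr : ∀ i, d 0 * r i 0 + d 1 * r i 1 = 0 := fun i => by
      simpa [dotProduct, Fin.sum_univ_three, hd2] using
        hdW _ (Submodule.mem_sup_left (Submodule.subset_span ⟨i, rfl⟩))
    have hN : d 0 ^ 2 + d 1 ^ 2 ≠ 0 := by
      intro h
      apply hd
      ext i
      fin_cases i <;> simp [hd2] <;> nlinarith [sq_nonneg (d 0), sq_nonneg (d 1)]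
    -- This is `d` turned by a right angle in the plane; every input, being orthogonal to `d`, is a
    -- multiple of it.
    have hd' : ![-d 1, d 0, 0] ≠ 0 := by
      intro h
      apply hN
      have a0 := congrFun h 0
      have a1 := congrFun h 1
      simp at a0 a1
      rw [a0, a1]; norm_num
    obtain ⟨Q, hQ, t, _, hQd⟩ := exists_orthogonal_mulVec_axis hd'
    have hr : ∀ i, r i = ((-d 1 * r i 0 + d 0 * r i 1) / (d 0 ^ 2 + d 1 ^ 2)) • ![-d 1, d 0, 0] := by
      intro i
      ext j
      fin_cases j
      · simp
        field_simp
        linear_combination d 0 * hdr i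
      · simp
        field_simp
        linear_combination d 1 * hdr i
      · simp [h2]
    have hQr : ∀ i, Q.mulVec (r i)
        = ((-d 1 * r i 0 + d 0 * r i 1) / (d 0 ^ 2 + d 1 ^ 2)) • ![0, 0, t] := fun i => by
      conv_lhs => rw [hr i]
      rw [Matrix.mulVec_smul, hQd]
    refine tensorForm_mem_of_mulVec hT hQ (tensorForm_mem_of_axis hT ?_ ?_) <;>
      intro i <;> rw [hQr] <;> simp

/-- For spanning inputs no symmetry is needed, since all basis forms are available. Otherwise a
normal vector to the inputs is rotated onto the third axis, which puts them in the plane z = 0. -/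
theorem tensorForm_mem (hT : IsProperHarmonicTensor T) (r : Fin n → Fin 3 → ℝ) :
    tensorForm (T r) ∈ inputSpan r ^ L := by
  by_cases hW : Submodule.span ℝ (Set.range r) = ⊤
  · have hmem : ∀ a, vecForm a ∈ inputSpan r := fun a =>
      vecForm_mem_inputSpan (by rw [hW]; trivial)
    obtain ⟨hu, hv⟩ := squares_mem (hmem _) (hmem _)
    have huv := fst_mul_snd_mem (a := ![0, 0, 1]) (by simp) (by simp) (by simp) (hmem _)
    exact tensorForm_mem_of_forall_basis _ fun m hm => Or.inr (spinorBasis_mem hu hv huv hm)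
  · obtain ⟨d, hd, hdW⟩ := exists_dotProduct_eq_zero hW
    obtain ⟨Q, hQ, t, ht, hQd⟩ := exists_orthogonal_mulVec_axis hd
    refine tensorForm_mem_of_mulVec hT hQ (tensorForm_mem_of_plane hT fun i => ?_)
    have h1 : Q.mulVec d ⬝ᵥ Q.mulVec (r i) = 0 := by
      have : Q.transpose * Q = 1 := by
        simpa [Matrix.star_eq_conjTranspose] using Unitary.star_mul_self_of_mem hQ
      rw [Matrix.dotProduct_mulVec, Matrix.vecMul_mulVec, this, Matrix.vecMul_one]
      exact hdW _ (Submodule.subset_span ⟨i, rfl⟩)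
    rw [hQd] at h1
    simpa [dotProduct, Fin.sum_univ_three, ht] using h1

end ProperHarmonicTensor

/-! ### Scalar coefficients -/

/-- The number of occurrences of each input in a list of inputs. -/
def occurrences {n L : ℕ} (i : Fin L → Fin n) (k : Fin n) : ℕ :=
  (Finset.univ.filter fun j => i j = k).card

theorem sum_occurrences {n L : ℕ} (i : Fin L → Fin n) : ∑ k, occurrences i k = L := by
  have := Finset.card_eq_sum_card_fiberwise (f := i) (s := Finset.univ) (t := Finset.univ)
    (fun _ _ => Finset.mem_univ _)
  simpa [occurrences] using this.symm

theorem prod_vecForm_eq {n L : ℕ} (r : Fin n → Fin 3 → ℝ) (i : Fin L → Fin n) :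
    ∏ j, vecForm (r (i j)) = ∏ k, vecForm (r k) ^ occurrences i k := by
  simp only [occurrences, ← Finset.prod_const]
  exact (Finset.prod_fiberwise' Finset.univ i fun k => vecForm (r k)).symm

/-- Coefficients at a single input, for a family of couplings that contains all monomials. -/
theorem exists_real_coefficients {n L : ℕ} {T : (Fin n → Fin 3 → ℝ) → MIdx L → ℝ}
    (hT : IsProperHarmonicTensor T) {κ : Type*} (s : Finset κ) (e : κ → Fin n → ℕ)
    (he : ∀ k ∈ s, ∑ j, e k j = L)
    (hsurj : ∀ i : Fin L → Fin n, ∃ k ∈ s, e k = occurrences i)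
    (G : κ → (Fin n → Fin 3 → ℝ) → ℤ → ℂ)
    (hG : ∀ k ∈ s, ∀ r, spinorForm L (G k r) = ∏ j, vecForm (r j) ^ e k j)
    (r : Fin n → Fin 3 → ℝ) :
    ∃ c : κ → ℝ, tensorForm (T r) = ∑ k ∈ s, (c k : ℂ) • ∏ j, vecForm (r j) ^ e k j := by
  have hmem : tensorForm (T r) ∈
      Submodule.span ℂ ((fun k => ∏ j, vecForm (r j) ^ e k j) '' (s : Set κ)) := by
    have h := tensorForm_mem hT r
    -- The power of a span is spanned by the products of `L` generators, that is by the monomials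
    -- that `hsurj` provides.
    rw [inputSpan, Submodule.span_pow] at h
    refine Submodule.span_mono ?_ h
    intro x hx
    rw [Set.mem_pow] at hx
    obtain ⟨f, rfl⟩ := hx
    choose i hi using fun j => (f j).2
    obtain ⟨k, hk, hek⟩ := hsurj i
    refine ⟨k, hk, ?_⟩
    simp only [hek]
    rw [← prod_vecForm_eq, List.prod_ofFn]
    exact Finset.prod_congr rfl fun j _ => hi j
  obtain ⟨z, hz⟩ := (Submodule.mem_span_image_finset_iff_exists_fun' ℂ).mp hmem
  have hsum : ∀ z : κ → ℂ, spinorForm L (fun μ => ∑ k ∈ s, z k * G k r μ)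
      = ∑ k ∈ s, z k • ∏ j, vecForm (r j) ^ e k j := by
    intro z
    ext w
    rw [Finset.sum_apply, spinorForm]
    simp only [Finset.sum_mul]
    rw [Finset.sum_comm]
    refine Finset.sum_congr rfl fun k hk => ?_
    rw [← hG k hk, Pi.smul_apply, smul_eq_mul, spinorForm, Finset.mul_sum]
    exact Finset.sum_congr rfl fun μ _ => by ring
  -- Both `T r` and the couplings have real components, so taking real parts preserves the
  -- expansion; the monomials need not be independent.
  refine ⟨fun k => (z k).re, ?_⟩
  rw [← hsum]
  refine spinorForm_congr fun μ hμ => ?_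
  have h1 : tensorComp (T r) μ = ∑ k ∈ s, z k * G k r μ :=
    eq_of_spinorForm_eq (hz.symm.trans (hsum z).symm) μ hμ
  have hreal : ∀ k ∈ s, G k r μ = ((G k r μ).re : ℂ) := fun k hk =>
    (Complex.conj_eq_iff_re.mp
      (conj_eq_self_of_spinorForm_eq_prod (he k hk) (hG k hk r) μ hμ)).symm
  have h2 : tensorComp (T r) μ = ((tensorComp (T r) μ).re : ℂ) := by
    rw [tensorComp, dif_pos hμ, Complex.ofReal_re]
  rw [h2, h1, Complex.re_sum, Complex.ofReal_sum]
  refine Finset.sum_congr rfl fun k hk => ?_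
  rw [hreal k hk]
  simp

/-- Inputs that are related by an orthogonal transformation. -/
def orthogonalSetoid (n : ℕ) : Setoid (Fin n → Fin 3 → ℝ) where
  r a b := ∃ Q ∈ Matrix.orthogonalGroup (Fin 3) ℝ, b = fun i => Q.mulVec (a i)
  iseqv :=
    { refl := fun a => ⟨1, one_mem _, by simp⟩
      symm := by
        rintro a _ ⟨Q, hQ, rfl⟩
        refine ⟨star Q, Unitary.star_mem hQ, ?_⟩
        simp [Matrix.mulVec_mulVec, Unitary.star_mul_self_of_mem hQ]
      trans := by
        rintro a _ _ ⟨Q, hQ, rfl⟩ ⟨R, hR, rfl⟩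
        exact ⟨R * Q, mul_mem hR hQ, by simp [Matrix.mulVec_mulVec]⟩ }

/-- A representative of the orbit of the inputs under the orthogonal group. -/
noncomputable def orbitRep {n : ℕ} (r : Fin n → Fin 3 → ℝ) : Fin n → Fin 3 → ℝ :=
  (Quotient.mk (orthogonalSetoid n) r).out

theorem exists_eq_mulVec_orbitRep {n : ℕ} (r : Fin n → Fin 3 → ℝ) :
    ∃ Q ∈ Matrix.orthogonalGroup (Fin 3) ℝ, r = fun i => Q.mulVec (orbitRep r i) :=
  Quotient.mk_out (s := orthogonalSetoid n) r

theorem orbitRep_mulVec {n : ℕ} {Q : Matrix (Fin 3) (Fin 3) ℝ}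
    (hQ : Q ∈ Matrix.orthogonalGroup (Fin 3) ℝ) (r : Fin n → Fin 3 → ℝ) :
    orbitRep (fun i => Q.mulVec (r i)) = orbitRep r :=
  congrArg Quotient.out (Quotient.sound (s := orthogonalSetoid n)
    ((orthogonalSetoid n).symm ⟨Q, hQ, rfl⟩))

/-- A proper harmonic tensor is a combination, with scalar coefficients, of any family of couplings
that contains all monomials in the inputs. -/
theorem exists_scalar_expansion {n L : ℕ} {T : (Fin n → Fin 3 → ℝ) → MIdx L → ℝ}
    (hT : IsProperHarmonicTensor T) {κ : Type*} (s : Finset κ) (e : κ → Fin n → ℕ)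
    (he : ∀ k ∈ s, ∑ j, e k j = L)
    (hsurj : ∀ i : Fin L → Fin n, ∃ k ∈ s, e k = occurrences i)
    (G : κ → (Fin n → Fin 3 → ℝ) → ℤ → ℂ)
    (hG : ∀ k ∈ s, ∀ r, spinorForm L (G k r) = ∏ j, vecForm (r j) ^ e k j) :
    ∃ f : κ → (Fin n → Fin 3 → ℝ) → ℝ, (∀ k, IsScalarFunction (f k)) ∧
      ∀ (r : Fin n → Fin 3 → ℝ) (μ : MIdx L),
        (T r μ : ℂ) = ∑ k ∈ s, (f k r : ℂ) * G k r μ := by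
  choose c hc using exists_real_coefficients hT s e he hsurj G hG
  -- Coefficients read off at the orbit representative are constant along orbits, hence scalar
  -- functions, however they were chosen there.
  refine ⟨fun k r => c (orbitRep r) k, fun k Q hQ r => ?_, fun r μ => ?_⟩
  · simp only [orbitRep_mulVec hQ]
  rw [← tensorComp_apply]
  refine eq_of_spinorForm_eq (B := fun μ => ∑ k ∈ s, (c (orbitRep r) k : ℂ) * G k r μ) ?_ μ μ.2
  obtain ⟨Q, hQ, hr⟩ := exists_eq_mulVec_orbitRep r
  -- The same `g` and `ε` serve `T` and all vectors. A monomial of degree `L` acquires the factor `ε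
  -- ^ L`, just as `T` does.
  obtain ⟨ε, g, -, hv, hF⟩ := exists_substitution hQ hT
  ext w
  have h1 : tensorForm (T r) w = ε ^ L * tensorForm (T (orbitRep r)) (g w) := by
    conv_lhs => rw [hr]
    exact hF _ w
  have h2 : ∀ j, vecForm (r j) w = ε * vecForm (orbitRep r j) (g w) := by
    intro j
    conv_lhs => rw [hr]
    exact hv _ w
  rw [show spinorForm L (tensorComp (T r)) w = _ from h1, hc, Finset.sum_apply, spinorForm,
    Finset.mul_sum]
  simp only [Finset.sum_mul]
  rw [Finset.sum_comm]
  refine Finset.sum_congr rfl fun k hk => ?_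
  have h3 : spinorForm L (G k r) w = ε ^ L * ∏ j, vecForm (orbitRep r j) (g w) ^ e k j := by
    rw [hG k hk, Finset.prod_apply]
    simp only [Pi.pow_apply, h2, mul_pow, Finset.prod_mul_distrib, Finset.prod_pow_eq_pow_sum,
      he k hk]
  simp only [mul_assoc]
  rw [← Finset.mul_sum, ← spinorForm, h3, Pi.smul_apply, Finset.prod_apply, smul_eq_mul]
  simp only [Pi.pow_apply]
  ring

theorem occurrences_comp_perm {n L : ℕ} (i : Fin L → Fin n) (σ : Equiv.Perm (Fin L)) :
    occurrences (i ∘ σ) = occurrences i := by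
  ext k
  exact Finset.card_equiv σ (by simp)

open Classical in
theorem corollary2 (n L : ℕ) (T : (Fin n → Fin 3 → ℝ) → MIdx L → ℝ)
    (hT : IsProperHarmonicTensor T) :
    (∃ f : (Fin L → Fin n) → (Fin n → Fin 3 → ℝ) → ℝ,
      (∀ i, IsScalarFunction (f i)) ∧
      ∀ (r : Fin n → Fin 3 → ℝ) (μ : MIdx L),
        (T r μ : ℂ) = ∑ i ∈ Finset.univ.filter (fun i : Fin L → Fin n => Monotone i),
          (f i r : ℂ) * maxCoupling L (fun j => r (i j)) μ) ∧
    (∃ phi : (Fin n → ℕ) → (Fin n → Fin 3 → ℝ) → ℝ,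
      (∀ l, IsScalarFunction (phi l)) ∧
      ∀ (r : Fin n → Fin 3 → ℝ) (μ : MIdx L),
        (T r μ : ℂ) = ∑ l ∈ Finset.piAntidiag (Finset.univ : Finset (Fin n)) L,
          (phi l r : ℂ) * blockCoupling n l r μ) := by
  constructor
  · refine exists_scalar_expansion hT _ occurrences (fun i _ => sum_occurrences i) (fun i => ?_)
      (fun i r => maxCoupling L fun j => r (i j)) (fun i _ r => ?_)
    -- Sorting the indices makes the tuple monotone without changing its monomial.
    · exact ⟨i ∘ Tuple.sort i, by simpa using Tuple.monotone_sort i, occurrences_comp_perm i _⟩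
    · rw [spinorForm_maxCoupling, prod_vecForm_eq]
  · refine exists_scalar_expansion hT _ id (fun l hl => ?_) (fun i => ?_)
      (fun l r => blockCoupling n l r) (fun l hl r => ?_)
    · simpa using hl
    · exact ⟨occurrences i, by simpa using sum_occurrences i, rfl⟩
    · have hl' : ∑ j, l j = L := by simpa using hl
      rw [← hl', spinorForm_blockCoupling]; rfl
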